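/- Let $L>0$. For a real, square integrable, $L$-periodic function $f$ let $\hat f(k)=\frac1L\int_0^L f(x)e^{-2\pi i kx/L}\,dx$, $k\in\mathbb Z$. For $s\ge 0$ let $H^s_{per}$ be the space of those $f$ with $\|f\|_{H^s_{per}}^2=L\sum_{k\in\mathbb Z}(1+|k|^2)^s|\hat f(k)|^2<\infty$, let $H^s_{per,m}=\{f\in H^s_{per}:\frac1L\int_0^L f\,dx=0\}$ with the norm of $H^s_{per}$, and $L^2_{per,m}=H^0_{per,m}$. **Theorem (local well-posedness).** Let $(\phi_0,\phi_1)\in H^3_{per,m}\times H^2_{per,m}$. There exist $t_{\max}>0$ and a unique strong solution $\phi$ on $[0,t_{\max})$ of the Cauchy problem $$\phi_{tt}-\phi_{xx}-\phi+\phi^3-\frac1L\int_0^L\phi^3\,dx=0,\qquad \phi(\cdot,0)=\phi_0,\quad \phi_t(\cdot,0)=\phi_1,$$ satisfying $$(\phi,\phi_t)\in C\big([0,t_{\max}),H^3_{per,m}\times H^2_{per,m}\big)\cap C^1\big([0,t_{\max}),H^2_{per,m}\times L^2_{per,m}\big).$$ Here a strong solution is a function of this regularity for which the equation holds in $L^2_{per}$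 at every time $t$ of the interval, where $\phi_t$ is the derivative in $H^2_{per,m}$, $\phi_{tt}$ is the derivative of $\phi_t$ in $L^2_{per,m}$ (both one-sided at $t=0$), and $\phi_{xx}\in L^2_{per}$ is the weak periodic derivative. Uniqueness means: for every $0<T\le t_{\max}$, every strong solution on $[0,T)$ with the same data and with this regularity on $[0,T)$ coincides with $\phi$ on $[0,T)$. -/

import Mathlib

open MeasureTheory Set
open scoped ENNReal

noncomputable section

namespace PerSobolev

/-- The space of real square integrable functions that are `L`-periodic (modulo equality almost
everywhere), with Lebesgue measure of total mass `L` on the circle `ℝ / Lℤ`. -/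
abbrev L2per (L : ℝ) [Fact (0 < L)] : Type := Lp ℝ 2 (volume : Measure (AddCircle L))

/-- The periodic Fourier transform,
`f̂(k) = (1 / L) ∫₀ᴸ f(x) exp(- 2 π i k x / L) dx`. -/
def fhat {L : ℝ} [Fact (0 < L)] (f : L2per L) (k : ℤ) : ℂ :=
  fourierCoeff (fun x : AddCircle L => ((f x : ℝ) : ℂ)) k

section helpers

variable {L : ℝ} [Fact (0 < L)]

theorem memLp_ofReal (f : L2per L) :
    MemLp (fun x : AddCircle L => ((f x : ℝ) : ℂ)) 2 (AddCircle.haarAddCircle (T := L)) :=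
  memLp_haarAddCircle_iff.2 ((Lp.memLp f).ofReal)

theorem ae_haar_of_ae {p : AddCircle L → Prop} (h : ∀ᵐ x : AddCircle L, p x) :
    ∀ᵐ x ∂(AddCircle.haarAddCircle (T := L)), p x := by
  have hL : (0 : ℝ) < L := Fact.out
  rw [AddCircle.volume_eq_smul_haarAddCircle] at h
  exact (Measure.ae_ennreal_smul_measure_iff (by simpa using hL)).1 h

theorem ae_of_ae_haar {p : AddCircle L → Prop}
    (h : ∀ᵐ x ∂(AddCircle.haarAddCircle (T := L)), p x) : ∀ᵐ x : AddCircle L, p x := by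
  rw [AddCircle.volume_eq_smul_haarAddCircle]
  exact Measure.ae_smul_measure h _

theorem fhat_add (f g : L2per L) (k : ℤ) : fhat (f + g) k = fhat f k + fhat g k := by
  unfold fhat
  have h1 : (fun x : AddCircle L => (((f + g : L2per L) x : ℝ) : ℂ))
      =ᵐ[AddCircle.haarAddCircle (T := L)]
      (fun x => ((f x : ℝ) : ℂ)) + fun x => ((g x : ℝ) : ℂ) := by
    filter_upwards [ae_haar_of_ae (Lp.coeFn_add f g)] with x hx
    rw [hx]
    simp
  rw [fourierCoeff_congr_ae h1, fourierCoeff.add ((memLp_ofReal f).integrable (by norm_num))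
    ((memLp_ofReal g).integrable (by norm_num))]
  rfl

theorem fhat_smul (c : ℝ) (f : L2per L) (k : ℤ) : fhat (c • f) k = c • fhat f k := by
  unfold fhat
  have h1 : (fun x : AddCircle L => (((c • f : L2per L) x : ℝ) : ℂ))
      =ᵐ[AddCircle.haarAddCircle (T := L)]
      fun x => (c : ℂ) * ((f x : ℝ) : ℂ) := by
    filter_upwards [ae_haar_of_ae (Lp.coeFn_smul c f)] with x hx
    simp [hx]
  rw [fourierCoeff_congr_ae h1, fourierCoeff.const_mul]
  simp

theorem fhat_zero (k : ℤ) : fhat (0 : L2per L) k = 0 := by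
  simpa using fhat_smul (0 : ℝ) (0 : L2per L) k

theorem eq_zero_of_fhat (f : L2per L) (h : ∀ k, fhat f k = 0) : f = 0 := by
  have hF : (memLp_ofReal f).toLp _ = 0 := by
    apply (fourierBasis (T := L)).repr.injective
    ext k
    rw [fourierBasis_repr, fourierCoeff_congr_ae (memLp_ofReal f).coeFn_toLp]
    have hk : fourierCoeff (fun x : AddCircle L => ((f x : ℝ) : ℂ)) k = 0 := h k
    simpa using hk
  have h0 : (fun x : AddCircle L => ((f x : ℝ) : ℂ)) =ᵐ[AddCircle.haarAddCircle (T := L)] 0 := by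
    rw [← MemLp.toLp_zero (MemLp.zero'), MemLp.toLp_eq_toLp_iff] at hF
    exact hF
  rw [Lp.eq_zero_iff_ae_eq_zero]
  filter_upwards [ae_of_ae_haar h0] with x hx
  simpa using hx

theorem norm_add_sq_le (a b : ℂ) : ‖a + b‖ ^ 2 ≤ 2 * ‖a‖ ^ 2 + 2 * ‖b‖ ^ 2 := by
  have h := norm_add_le a b
  have h0 := norm_nonneg (a + b)
  nlinarith [sq_nonneg (‖a‖ - ‖b‖)]

end helpers

/-- The periodic Sobolev space `H^s_per`, as a set of functions:
`∑_k (1 + |k|²)^s |f̂(k)|² < ∞`. -/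
def hper (L : ℝ) [Fact (0 < L)] (s : ℕ) : Submodule ℝ (L2per L) where
  carrier := {f | Summable fun k : ℤ => (1 + (k : ℝ) ^ 2) ^ s * ‖fhat f k‖ ^ 2}
  add_mem' := by
    intro f g hf hg
    refine Summable.of_nonneg_of_le (fun k => by positivity) (fun k => ?_)
      ((hf.mul_left 2).add (hg.mul_left 2))
    rw [fhat_add]
    have h : (0 : ℝ) ≤ (1 + (k : ℝ) ^ 2) ^ s := by positivity
    nlinarith [mul_le_mul_of_nonneg_left (norm_add_sq_le (fhat f k) (fhat g k)) h]
  zero_mem' := by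
    simp [fhat_zero, summable_zero]
  smul_mem' := by
    intro c f hf
    refine (hf.mul_left (c ^ 2)).congr fun k => ?_
    rw [fhat_smul, norm_smul, mul_pow, Real.norm_eq_abs, sq_abs]
    ring

/-- The functions of mean zero, `(1 / L) ∫₀ᴸ f dx = 0`. -/
def zeroMean (L : ℝ) [Fact (0 < L)] : Submodule ℝ (L2per L) where
  carrier := {f | 1 / L * (∫ x : AddCircle L, f x) = 0}
  add_mem' := by
    intro f g hf hg
    simp only [mem_ofPred_eq] at hf hg ⊢
    rw [integral_congr_ae (Lp.coeFn_add f g)]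
    simp only [Pi.add_apply]
    rw [integral_add ((Lp.memLp f).integrable (by norm_num))
      ((Lp.memLp g).integrable (by norm_num)), mul_add, hf, hg, add_zero]
  zero_mem' := by
    simp only [mem_ofPred_eq]
    rw [integral_congr_ae (Lp.coeFn_zero ℝ 2 _)]
    simp
  smul_mem' := by
    intro c f hf
    simp only [mem_ofPred_eq] at hf ⊢
    rw [integral_congr_ae (Lp.coeFn_smul c f)]
    simp only [Pi.smul_apply]
    rw [integral_smul, smul_eq_mul, mul_left_comm, hf, mul_zero]

theorem hper_mono (L : ℝ) [Fact (0 < L)] {r s : ℕ} (h : r ≤ s) : hper L s ≤ hper L r := by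
  intro f hf
  refine Summable.of_nonneg_of_le (fun k => by positivity) (fun k => ?_) hf
  exact mul_le_mul_of_nonneg_right
    (pow_le_pow_right₀ (by nlinarith [sq_nonneg (k : ℝ)]) h) (by positivity)

/-- The space `H^s_{per,m}` of mean zero elements of `H^s_per`. This is a type of its own: it
carries the `H^s_per` norm (see below) and not the norm of `L²`. -/
@[ext]
structure HperM (L : ℝ) [Fact (0 < L)] (s : ℕ) where
  /-- the underlying square integrable function -/
  toL2 : L2per L
  mem_hper : toL2 ∈ hper L s
  mem_zeroMean : toL2 ∈ zeroMean L

namespace HperM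

variable {L : ℝ} [Fact (0 < L)] {r s : ℕ}

theorem toL2_injective : Function.Injective (toL2 : HperM L s → L2per L) :=
  fun _ _ h => HperM.ext h

instance : Zero (HperM L s) := ⟨⟨0, zero_mem _, zero_mem _⟩⟩

instance : Add (HperM L s) :=
  ⟨fun f g => ⟨f.toL2 + g.toL2, add_mem f.2 g.2, add_mem f.3 g.3⟩⟩

instance : Neg (HperM L s) := ⟨fun f => ⟨-f.toL2, neg_mem f.2, neg_mem f.3⟩⟩

instance : Sub (HperM L s) :=
  ⟨fun f g => ⟨f.toL2 - g.toL2, sub_mem f.2 g.2, sub_mem f.3 g.3⟩⟩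

instance : SMul ℕ (HperM L s) :=
  ⟨fun n f => ⟨n • f.toL2, nsmul_mem f.2 n, nsmul_mem f.3 n⟩⟩

instance : SMul ℤ (HperM L s) :=
  ⟨fun n f => ⟨n • f.toL2, zsmul_mem f.2 n, zsmul_mem f.3 n⟩⟩

instance : SMul ℝ (HperM L s) :=
  ⟨fun c f => ⟨c • f.toL2, Submodule.smul_mem _ c f.2, Submodule.smul_mem _ c f.3⟩⟩

instance : AddCommGroup (HperM L s) :=
  toL2_injective.addCommGroup toL2 rfl (fun _ _ => rfl) (fun _ => rfl) (fun _ _ => rfl)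
    (fun _ _ => rfl) (fun _ _ => rfl)

@[simp] theorem toL2_zero : (0 : HperM L s).toL2 = 0 := rfl

@[simp] theorem toL2_add (f g : HperM L s) : (f + g).toL2 = f.toL2 + g.toL2 := rfl

@[simp] theorem toL2_neg (f : HperM L s) : (-f).toL2 = -f.toL2 := rfl

@[simp] theorem toL2_sub (f g : HperM L s) : (f - g).toL2 = f.toL2 - g.toL2 := rfl

@[simp] theorem toL2_smul (c : ℝ) (f : HperM L s) : (c • f).toL2 = c • f.toL2 := rfl

instance : Module ℝ (HperM L s) :=
  toL2_injective.module ℝ ⟨⟨toL2, toL2_zero⟩, toL2_add⟩ toL2_smul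

theorem sq_weighted (f : L2per L) (k : ℤ) :
    ‖Real.sqrt (L * (1 + (k : ℝ) ^ 2) ^ s) • fhat f k‖ ^ 2
      = L * ((1 + (k : ℝ) ^ 2) ^ s * ‖fhat f k‖ ^ 2) := by
  have hL : (0 : ℝ) < L := Fact.out
  rw [norm_smul, mul_pow, Real.norm_eq_abs, sq_abs, Real.sq_sqrt (by positivity)]
  ring

theorem memℓp_weighted (f : HperM L s) :
    Memℓp (fun k : ℤ => Real.sqrt (L * (1 + (k : ℝ) ^ 2) ^ s) • fhat f.toL2 k) 2 := by
  refine memℓp_gen ?_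
  have h : Summable fun k : ℤ => (1 + (k : ℝ) ^ 2) ^ s * ‖fhat f.toL2 k‖ ^ 2 := f.mem_hper
  refine (h.mul_left L).congr fun k => ?_
  rw [← sq_weighted]
  simp

/-- The weighted Fourier coefficients `(L (1 + |k|²)^s)^(1/2) f̂(k)`, a square summable sequence. -/
def weighted : HperM L s →ₗ[ℝ] lp (fun _ : ℤ => ℂ) 2 where
  toFun f := ⟨fun k => Real.sqrt (L * (1 + (k : ℝ) ^ 2) ^ s) • fhat f.toL2 k, memℓp_weighted f⟩
  map_add' f g := by
    ext k
    have h : ∀ c : ℝ, c • fhat (toL2 (f + g)) k = c • fhat f.toL2 k + c • fhat g.toL2 k := by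
      intro c
      rw [toL2_add, fhat_add, smul_add]
    exact h _
  map_smul' c f := by
    ext k
    simp [fhat_smul, mul_left_comm]

theorem weighted_injective : Function.Injective (weighted : HperM L s → lp (fun _ : ℤ => ℂ) 2) := by
  have hL : (0 : ℝ) < L := Fact.out
  refine (injective_iff_map_eq_zero (weighted : HperM L s →ₗ[ℝ] _)).2 fun f hf => ?_
  apply toL2_injective
  refine eq_zero_of_fhat _ fun k => ?_
  have h : Real.sqrt (L * (1 + (k : ℝ) ^ 2) ^ s) • fhat f.toL2 k = 0 :=
    congrFun (congrArg Subtype.val hf) k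
  refine (smul_eq_zero.1 h).resolve_left ?_
  positivity

instance : NormedAddCommGroup (HperM L s) :=
  NormedAddCommGroup.induced (HperM L s) (lp (fun _ : ℤ => ℂ) 2) weighted weighted_injective

instance : NormedSpace ℝ (HperM L s) :=
  NormedSpace.induced ℝ (HperM L s) (lp (fun _ : ℤ => ℂ) 2) weighted

/-- The norm of `H^s_{per,m}` is the norm of `H^s_per`. -/
theorem norm_sq_eq (f : HperM L s) :
    ‖f‖ ^ 2 = L * ∑' k : ℤ, (1 + (k : ℝ) ^ 2) ^ s * ‖fhat f.toL2 k‖ ^ 2 := by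
  have h := lp.norm_rpow_eq_tsum (p := 2) (by norm_num) (weighted f)
  rw [← tsum_mul_left]
  simp only [ENNReal.toReal_ofNat, Real.rpow_ofNat] at h
  refine Eq.trans h (tsum_congr fun k => ?_)
  exact sq_weighted _ _

/-- The inclusion of `H^s_{per,m}` into `H^r_{per,m}` for `r ≤ s`. -/
def incl (h : r ≤ s) : HperM L s →ₗ[ℝ] HperM L r where
  toFun f := ⟨f.toL2, hper_mono L h f.mem_hper, f.mem_zeroMean⟩
  map_add' _ _ := rfl
  map_smul' _ _ := rfl

@[simp] theorem toL2_incl (h : r ≤ s) (f : HperM L s) : (incl h f).toL2 = f.toL2 := by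
  simp only [incl, LinearMap.coe_mk, AddHom.coe_mk]

end HperM

/-- `g = ∂ₓⁿ f` in the sense of periodic distributions: `ĝ(k) = (2 π i k / L)^n f̂(k)` for every
integer `k`. -/
def IsDerivX {L : ℝ} [Fact (0 < L)] (n : ℕ) (f g : L2per L) : Prop :=
  ∀ k : ℤ, fhat g k = (2 * Real.pi * Complex.I * k / L) ^ n * fhat f k

section solutions

variable {L : ℝ} [Fact (0 < L)]

/-- `φ_t` on `[0, T)`, the derivative in `H²_{per,m}` (one-sided at `t = 0`). -/
def dt (T : ℝ) (φ : ℝ → HperM L 3) (t : ℝ) : HperM L 2 :=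
  derivWithin (fun τ => HperM.incl (show 2 ≤ 3 by norm_num) (φ τ)) (Ico 0 T) t

/-- `φ_tt` on `[0, T)`, the derivative of `φ_t` in `L²_{per,m} = H⁰_{per,m}` (one-sided at
`t = 0`). -/
def dtt (T : ℝ) (φ : ℝ → HperM L 3) (t : ℝ) : HperM L 0 :=
  derivWithin (fun τ => HperM.incl (show 0 ≤ 2 by norm_num) (dt T φ τ)) (Ico 0 T) t

/-- `φ` is a strong solution on `[0, T)` of
`φ_tt - φ_xx - φ + φ³ - (1 / L) ∫₀ᴸ φ³ dx = 0`, `φ(0) = φ₀`, `φ_t(0) = φ₁`. -/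
structure IsStrongSolution (T : ℝ) (φ₀ : HperM L 3) (φ₁ : HperM L 2) (φ : ℝ → HperM L 3) :
    Prop where
  /-- `(φ, φ_t) ∈ C([0, T), H³_{per,m} × H²_{per,m})` -/
  continuousOn : ContinuousOn (fun t => (φ t, dt T φ t)) (Ico 0 T)
  /-- `(φ, φ_t) ∈ C¹([0, T), H²_{per,m} × L²_{per,m})` -/
  contDiffOn : ContDiffOn ℝ 1
    (fun t => (HperM.incl (show 2 ≤ 3 by norm_num) (φ t),
      HperM.incl (show 0 ≤ 2 by norm_num) (dt T φ t))) (Ico 0 T)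
  /-- the equation holds in `L²` for every `t ∈ [0, T)` -/
  equation : ∀ t ∈ Ico 0 T, ∃ φxx : L2per L, IsDerivX 2 (φ t).toL2 φxx ∧
    ∀ᵐ x : AddCircle L,
      (dtt T φ t).toL2 x - φxx x - (φ t).toL2 x + (φ t).toL2 x ^ 3
        - 1 / L * (∫ y : AddCircle L, (φ t).toL2 y ^ 3) = 0
  init : φ 0 = φ₀
  init_dt : dt T φ 0 = φ₁

end solutions

end PerSobolev

end

noncomputable section

namespace PerSobolev

open Filter Topology ComplexConjugate

variable {L : ℝ} [Fact (0 < L)]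

/-! ### Real Fourier coefficients and Riesz–Fischer -/

section FourierCoefficients

/-! The equation becomes a semilinear first order system for `U = (|∂ₓ| φ, φ_t)` in `H² × H²`. On
mean zero functions `|∂ₓ|` is invertible, so `recover` returns `φ ∈ H³` from `U`. The linear part
generates the group `rot t`, which rotates each Fourier mode by the angle `t · freq L k`.
Subtracting the mean of the cube keeps the nonlinearity in the mean zero space.

Multiplication by `f ∈ H³` is bounded on `H^s` for `s ≤ 2`: it is the sum over `j` of `f̂(j)` times
a frequency shift by `j`, whose norm is at most `2 (1 + j²)`, and `∑ |f̂(j)| (1 + j²)` is controlled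
by the `H³` norm (`wiener_estimate`). Factoring a difference of cubes then gives
`norm_nonlin_sub_le`: on bounded sets of `H³` the nonlinearity is Lipschitz for every `H^s` norm
with `s ≤ 2`.

Existence uses `s = 2`. In the interaction picture `V(t) = rot (-t) U(t)` the unbounded generator
disappears and `V` solves an ODE in `H² × H²` with a locally Lipschitz right side, to which
Picard–Lindelöf applies. Going back, `U` is differentiable in `H¹ × H¹`, because the generator costs
one derivative; this is enough for `φ` to be differentiable in `H²` and `φ_t` in `L²`.

Uniqueness uses `s = 0`. A strong solution has `φ_t` differentiable only in `L²`, so the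
differential inequality for the difference of two interaction pictures is taken there. The `H³`
norms are bounded on compact time intervals by continuity, and Grönwall's inequality concludes
(`IsWaveFlow.eqOn`). -/

theorem fhat_neg (f : L2per L) (k : ℤ) : fhat f (-k) = conj (fhat f k) := by
  unfold fhat fourierCoeff
  rw [← integral_conj]
  refine integral_congr_ae (Eventually.of_forall fun x => ?_)
  simp only [smul_eq_mul, map_mul, Complex.conj_ofReal]
  rw [← fourier_neg]

theorem fhat_zero_eq_integral (f : L2per L) :
    fhat f 0 = ((1 / L * ∫ x : AddCircle L, f x : ℝ) : ℂ) := by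
  unfold fhat fourierCoeff
  rw [AddCircle.integral_haarAddCircle]
  simp only [neg_zero, fourier_zero, one_smul]
  rw [integral_complex_ofReal]
  simp

theorem mem_zeroMean_iff (f : L2per L) : f ∈ zeroMean L ↔ fhat f 0 = 0 := by
  rw [fhat_zero_eq_integral, Complex.ofReal_eq_zero]
  rfl

theorem fhat_sub (f g : L2per L) (k : ℤ) : fhat (f - g) k = fhat f k - fhat g k := by
  rw [sub_eq_add_neg, fhat_add, ← neg_one_smul ℝ g, fhat_smul, sub_eq_add_neg]
  simp

theorem eq_of_fhat {f g : L2per L} (h : ∀ k, fhat f k = fhat g k) : f = g := by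
  refine sub_eq_zero.1 (eq_zero_of_fhat _ fun k => ?_)
  rw [fhat_sub, h, sub_self]

theorem fourierCoeff_conj (f : AddCircle L → ℂ) (k : ℤ) :
    fourierCoeff (fun x => conj (f x)) k = conj (fourierCoeff f (-k)) := by
  unfold fourierCoeff
  rw [← integral_conj]
  refine integral_congr_ae (Eventually.of_forall fun x => ?_)
  simp only [smul_eq_mul, map_mul]
  rw [← fourier_neg, neg_neg]

/-- Riesz–Fischer gives a complex function; conjugate symmetry makes it and its conjugate have the
same coefficients, so passing to the real part changes none of them. -/
theorem exists_L2per_of_summable (c : ℤ → ℂ) (hs : Summable fun k => ‖c k‖ ^ 2)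
    (hc : ∀ k, c (-k) = conj (c k)) : ∃ f : L2per L, ∀ k, fhat f k = c k := by
  have hmem : Memℓp c 2 := memℓp_gen (by simpa using hs)
  set G := (fourierBasis (T := L)).repr.symm ⟨c, hmem⟩ with hG
  have hGc : ∀ k, fourierCoeff (G : AddCircle L → ℂ) k = c k := by
    intro k
    rw [← fourierBasis_repr, hG, LinearIsometryEquiv.apply_symm_apply]
  have hGmem : MemLp (G : AddCircle L → ℂ) 2 (AddCircle.haarAddCircle (T := L)) := Lp.memLp G
  have hre : MemLp (fun x : AddCircle L => (G x).re) 2 volume :=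
    (memLp_haarAddCircle_iff.1 hGmem).re
  refine ⟨hre.toLp _, fun k => ?_⟩
  unfold fhat
  have hae : (fun x : AddCircle L => ((hre.toLp _ x : ℝ) : ℂ))
      =ᵐ[AddCircle.haarAddCircle (T := L)]
      fun x => (1 / 2 : ℂ) * (((G : AddCircle L → ℂ) + fun x => conj (G x)) x) := by
    filter_upwards [ae_haar_of_ae hre.coeFn_toLp] with x hx
    rw [hx, Pi.add_apply, Complex.add_conj]
    push_cast
    ring
  have hint : Integrable (fun x : AddCircle L => conj (G x)) AddCircle.haarAddCircle :=
    (hGmem.star).integrable (by norm_num)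
  rw [fourierCoeff_congr_ae hae, fourierCoeff.const_mul,
    fourierCoeff.add (hGmem.integrable (by norm_num)) hint, Pi.add_apply, fourierCoeff_conj, hGc,
    hGc, hc, Complex.conj_conj]
  ring

end FourierCoefficients

/-! ### Completeness of the mean zero Sobolev spaces -/

namespace HperM

variable {r s : ℕ}

theorem ext_fhat {f g : HperM L s} (h : ∀ k, fhat f.toL2 k = fhat g.toL2 k) : f = g :=
  toL2_injective (eq_of_fhat h)

theorem fhat_toL2_zero (f : HperM L s) : fhat f.toL2 0 = 0 :=
  (mem_zeroMean_iff _).1 f.mem_zeroMean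

theorem one_le_weight (s : ℕ) (k : ℤ) : (1 : ℝ) ≤ (1 + (k : ℝ) ^ 2) ^ s :=
  one_le_pow₀ (by nlinarith [sq_nonneg (k : ℝ)])

theorem exists_of_coeff (c : ℤ → ℂ) (hs : Summable fun k : ℤ => (1 + (k : ℝ) ^ 2) ^ s * ‖c k‖ ^ 2)
    (hc : ∀ k, c (-k) = conj (c k)) (h0 : c 0 = 0) :
    ∃ f : HperM L s, ∀ k, fhat f.toL2 k = c k := by
  obtain ⟨f, hf⟩ := exists_L2per_of_summable (L := L) c
    (Summable.of_nonneg_of_le (fun k => by positivity)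
      (fun k => le_mul_of_one_le_left (by positivity) (one_le_weight s k)) hs) hc
  refine ⟨⟨f, ?_, (mem_zeroMean_iff _).2 (by rw [hf, h0])⟩, hf⟩
  change Summable _
  simpa only [hf] using hs

theorem summable_weighted (f : HperM L s) :
    Summable fun k : ℤ => (1 + (k : ℝ) ^ 2) ^ s * ‖fhat f.toL2 k‖ ^ 2 := f.mem_hper

theorem weighted_apply (f : HperM L s) (k : ℤ) :
    weighted f k = Real.sqrt (L * (1 + (k : ℝ) ^ 2) ^ s) • fhat f.toL2 k := rfl

theorem norm_weighted (f : HperM L s) : ‖weighted f‖ = ‖f‖ := rfl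

theorem norm_le_of_coeff_le {C : ℝ} (hC : 0 ≤ C) {f : HperM L s} {g : HperM L r}
    (h : ∀ k : ℤ, (1 + (k : ℝ) ^ 2) ^ r * ‖fhat g.toL2 k‖ ^ 2 ≤
      C ^ 2 * ((1 + (k : ℝ) ^ 2) ^ s * ‖fhat f.toL2 k‖ ^ 2)) : ‖g‖ ≤ C * ‖f‖ := by
  have hL : (0 : ℝ) < L := Fact.out
  refine (sq_le_sq₀ (norm_nonneg _) (by positivity)).1 ?_
  rw [mul_pow, norm_sq_eq, norm_sq_eq, mul_left_comm, ← tsum_mul_left (a := C ^ 2)]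
  exact mul_le_mul_of_nonneg_left
    (Summable.tsum_le_tsum h g.summable_weighted (f.summable_weighted.mul_left _)) hL.le

/-- The range of the weighted Fourier transform. -/
theorem range_weighted : range (weighted : HperM L s → lp (fun _ : ℤ => ℂ) 2) =
    {a | a 0 = 0 ∧ ∀ k, a (-k) = conj (a k)} := by
  have hL : (0 : ℝ) < L := Fact.out
  ext a
  constructor
  · rintro ⟨f, rfl⟩
    refine ⟨by rw [weighted_apply, fhat_toL2_zero, smul_zero], fun k => ?_⟩
    rw [weighted_apply, weighted_apply, fhat_neg]
    simp
  · rintro ⟨h0, hk⟩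
    set w : ℤ → ℝ := fun k => Real.sqrt (L * (1 + (k : ℝ) ^ 2) ^ s) with hw
    have hwpos : ∀ k, 0 < w k := fun k => by simp only [hw]; positivity
    have hwsq : ∀ k, w k ^ 2 = L * (1 + (k : ℝ) ^ 2) ^ s := fun k =>
      Real.sq_sqrt (by positivity)
    have ha : Summable fun k => ‖a k‖ ^ 2 := by
      simpa using (lp.memℓp a).summable (by norm_num)
    obtain ⟨f, hf⟩ := exists_of_coeff (L := L) (s := s) (fun k => (w k)⁻¹ • a k)
      ((ha.mul_left L⁻¹).congr fun k => by
        have h1 := hwsq k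
        have h2 := (hwpos k).ne'
        rw [norm_smul, mul_pow, norm_inv, inv_pow, Real.norm_eq_abs, sq_abs, h1]
        field_simp)
      (fun k => by
        rw [hk]
        have : w (-k) = w k := by simp [hw]
        rw [this]
        simp)
      (by simp [h0])
    refine ⟨f, ?_⟩
    ext k
    rw [weighted_apply, hf]
    exact smul_inv_smul₀ (hwpos k).ne' _

/-- The weighted Fourier transform is an isometry onto a set cut out of `ℓ²` by closed conditions on
single coordinates. Picard–Lindelöf needs this completeness. -/
instance : CompleteSpace (HperM L s) := by
  have hiso : Isometry (weighted : HperM L s → lp (fun _ : ℤ => ℂ) 2) :=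
    AddMonoidHomClass.isometry_of_norm _ norm_weighted
  refine (completeSpace_iff_isComplete_range hiso.isUniformInducing).2 ?_
  rw [range_weighted]
  have hev : ∀ k : ℤ, Continuous fun a : lp (fun _ : ℤ => ℂ) 2 => a k := fun k =>
    (lp.lipschitzWith_one_eval 2 k).continuous
  have heq : {a : lp (fun _ : ℤ => ℂ) 2 | a 0 = 0 ∧ ∀ k, a (-k) = conj (a k)} =
      {a | a 0 = 0} ∩ ⋂ k : ℤ, {a | a (-k) = conj (a k)} := by
    ext a
    simp
  rw [heq]
  exact ((isClosed_eq (hev 0) continuous_const).inter (isClosed_iInter fun k =>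
    isClosed_eq (hev (-k)) (Complex.continuous_conj.comp (hev k)))).isComplete

/-! ### Convergence and differentiation through Fourier coefficients -/

section Convergence

variable {ι : Type*} {l : Filter ι}

/-- Dominated convergence for the series that defines the squared norm. -/
theorem tendsto_zero_of_coeff {F : ι → HperM L s} {b : ℤ → ℝ} (hb : Summable b)
    (hF : ∀ k, Tendsto (fun i => fhat (F i).toL2 k) l (𝓝 0))
    (hbound : ∀ᶠ i in l, ∀ k : ℤ, (1 + (k : ℝ) ^ 2) ^ s * ‖fhat (F i).toL2 k‖ ^ 2 ≤ b k) :
    Tendsto F l (𝓝 0) := by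
  have h := tendsto_tsum_of_dominated_convergence (𝓕 := l)
    (f := fun i (k : ℤ) => (1 + (k : ℝ) ^ 2) ^ s * ‖fhat (F i).toL2 k‖ ^ 2) (g := fun _ => 0) hb
    (fun k => by
      have := (((hF k).norm).pow 2).const_mul ((1 + (k : ℝ) ^ 2) ^ s)
      simpa using this)
    (by
      filter_upwards [hbound] with i hi k
      rw [Real.norm_of_nonneg (by positivity)]
      exact hi k)
  have h2 : Tendsto (fun i => ‖F i‖ ^ 2) l (𝓝 0) := by
    simp only [norm_sq_eq]
    simpa using h.const_mul L
  rw [tendsto_zero_iff_norm_tendsto_zero]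
  have h3 := h2.sqrt
  simpa [Real.sqrt_sq (norm_nonneg _)] using h3

theorem tendsto_of_coeff {F : ι → HperM L s} {G : HperM L s} {b : ℤ → ℝ} (hb : Summable b)
    (hF : ∀ k, Tendsto (fun i => fhat (F i).toL2 k) l (𝓝 (fhat G.toL2 k)))
    (hbound : ∀ᶠ i in l, ∀ k : ℤ, (1 + (k : ℝ) ^ 2) ^ s * ‖fhat (F i).toL2 k‖ ^ 2 ≤ b k) :
    Tendsto F l (𝓝 G) := by
  rw [← tendsto_sub_nhds_zero_iff]
  refine tendsto_zero_of_coeff ((hb.mul_left 2).add (G.summable_weighted.mul_left 2))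
    (fun k => ?_) ?_
  · simp only [toL2_sub, fhat_sub]
    simpa using (hF k).sub_const (fhat G.toL2 k)
  · filter_upwards [hbound] with i hi k
    have h1 := norm_add_sq_le (fhat (F i).toL2 k) (-fhat G.toL2 k)
    rw [norm_neg, ← sub_eq_add_neg, ← fhat_sub, ← toL2_sub] at h1
    have h2 : (0 : ℝ) ≤ (1 + (k : ℝ) ^ 2) ^ s := by positivity
    nlinarith [mul_le_mul_of_nonneg_left h1 h2, hi k]

/-- The Lipschitz bound, with constant `b k` for the weighted square of mode `k`, dominates the
coefficients of the difference quotients uniformly in `τ`. -/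
theorem hasDerivAt_of_coeff {F : ℝ → HperM L s} {G : HperM L s} {t : ℝ} {b : ℤ → ℝ}
    (hb : Summable b) (hF : ∀ k, HasDerivAt (fun τ => fhat (F τ).toL2 k) (fhat G.toL2 k) t)
    (hbound : ∀ τ, ∀ k : ℤ,
      (1 + (k : ℝ) ^ 2) ^ s * ‖fhat (F τ).toL2 k - fhat (F t).toL2 k‖ ^ 2 ≤ b k * (τ - t) ^ 2) :
    HasDerivAt F G t := by
  rw [hasDerivAt_iff_tendsto_slope]
  refine tendsto_of_coeff hb (fun k => ?_) ?_
  · have h := (hasDerivAt_iff_tendsto_slope.1 (hF k))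
    refine h.congr fun τ => ?_
    rw [slope_def_module, slope_def_module, toL2_smul, fhat_smul, toL2_sub, fhat_sub]
  · filter_upwards [self_mem_nhdsWithin] with τ hτ k
    have hne : τ - t ≠ 0 := sub_ne_zero.2 hτ
    rw [slope_def_module, toL2_smul, fhat_smul, toL2_sub, fhat_sub, norm_smul, mul_pow, norm_inv,
      inv_pow, Real.norm_eq_abs, sq_abs, mul_left_comm, inv_mul_le_iff₀ (by positivity),
      mul_comm _ (b k)]
    exact hbound τ k

end Convergence

/-! ### Fourier multipliers -/

section Multipliers

/-- A real even symbol preserves conjugate symmetry, hence real functions. The bound is asked only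
for `k ≠ 0`, since the zero mode is absent; this admits the inverse of `|∂ₓ|`. -/
theorem exists_multiplier {m : ℤ → ℝ} (hm : ∀ k, m (-k) = m k) {C : ℝ}
    (hC : ∀ k : ℤ, k ≠ 0 → (1 + (k : ℝ) ^ 2) ^ r * m k ^ 2 ≤ C ^ 2 * (1 + (k : ℝ) ^ 2) ^ s)
    (f : HperM L s) : ∃ g : HperM L r, ∀ k, fhat g.toL2 k = m k • fhat f.toL2 k := by
  refine exists_of_coeff _ (Summable.of_nonneg_of_le (fun k => by positivity) (fun k => ?_)
    (f.summable_weighted.mul_left (C ^ 2))) (fun k => ?_) (by rw [fhat_toL2_zero, smul_zero])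
  · rcases eq_or_ne k 0 with rfl | hk
    · simp [fhat_toL2_zero]
    · rw [norm_smul, mul_pow, Real.norm_eq_abs, sq_abs, ← mul_assoc, ← mul_assoc]
      exact mul_le_mul_of_nonneg_right (hC k hk) (by positivity)
  · rw [hm, fhat_neg]
    simp

/-- The Fourier multiplier with a real even symbol `m`, as a map from `H^s_{per,m}` to
`H^r_{per,m}`. -/
def multiplier (m : ℤ → ℝ) (hm : ∀ k, m (-k) = m k) (C : ℝ) (h0 : 0 ≤ C)
    (hC : ∀ k : ℤ, k ≠ 0 → (1 + (k : ℝ) ^ 2) ^ r * m k ^ 2 ≤ C ^ 2 * (1 + (k : ℝ) ^ 2) ^ s) :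
    HperM L s →L[ℝ] HperM L r :=
  LinearMap.mkContinuous
    { toFun := fun f => (exists_multiplier hm hC f).choose
      map_add' := fun f g => ext_fhat fun k => by
        rw [(exists_multiplier hm hC _).choose_spec, toL2_add, toL2_add, fhat_add, fhat_add,
          (exists_multiplier hm hC _).choose_spec, (exists_multiplier hm hC _).choose_spec,
          smul_add]
      map_smul' := fun c f => ext_fhat fun k => by
        rw [(exists_multiplier hm hC _).choose_spec, toL2_smul, RingHom.id_apply, toL2_smul,
          fhat_smul, fhat_smul, (exists_multiplier hm hC _).choose_spec, smul_comm] }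
    C fun f => norm_le_of_coeff_le h0 fun k => by
      rw [LinearMap.coe_mk, AddHom.coe_mk, (exists_multiplier hm hC _).choose_spec]
      rcases eq_or_ne k 0 with rfl | hk
      · simp [fhat_toL2_zero]
      · rw [norm_smul, mul_pow, Real.norm_eq_abs, sq_abs, ← mul_assoc, ← mul_assoc]
        exact mul_le_mul_of_nonneg_right (hC k hk) (by positivity)

variable {m : ℤ → ℝ} {hm : ∀ k, m (-k) = m k} {C : ℝ} {h0 : 0 ≤ C}
  {hC : ∀ k : ℤ, k ≠ 0 → (1 + (k : ℝ) ^ 2) ^ r * m k ^ 2 ≤ C ^ 2 * (1 + (k : ℝ) ^ 2) ^ s}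

theorem fhat_multiplier (f : HperM L s) (k : ℤ) :
    fhat (multiplier m hm C h0 hC f).toL2 k = m k • fhat f.toL2 k :=
  (exists_multiplier hm hC f).choose_spec k

theorem norm_multiplier_le (f : HperM L s) : ‖multiplier m hm C h0 hC f‖ ≤ C * ‖f‖ :=
  ContinuousLinearMap.le_of_opNorm_le _ (LinearMap.mkContinuous_norm_le _ h0 _) f

/-- The inclusion of `H^s_{per,m}` into `H^r_{per,m}` for `r ≤ s`, as a bounded operator. -/
def inclCLM (h : r ≤ s) : HperM L s →L[ℝ] HperM L r :=
  LinearMap.mkContinuous (incl h) 1 fun f => norm_le_of_coeff_le zero_le_one fun k => by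
    rw [toL2_incl, one_pow, one_mul]
    exact mul_le_mul_of_nonneg_right
      (pow_le_pow_right₀ (by nlinarith [sq_nonneg (k : ℝ)]) h) (by positivity)

theorem toL2_inclCLM (h : r ≤ s) (f : HperM L s) : (inclCLM h f).toL2 = f.toL2 := rfl

end Multipliers

end HperM

end PerSobolev

end

/-! ### Multiplication by functions in `H³` -/

noncomputable section

namespace PerSobolev

open Filter Topology ComplexConjugate

variable {L : ℝ} [Fact (0 < L)] {s : ℕ}

/-- The weight `(L (1 + |k|²)^s)^(1/2)`. -/
def weight (L : ℝ) (s : ℕ) (k : ℤ) : ℝ := Real.sqrt (L * (1 + (k : ℝ) ^ 2) ^ s)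

theorem weight_pos (k : ℤ) : 0 < weight L s k := by
  have hL : (0 : ℝ) < L := Fact.out
  unfold weight
  positivity

theorem weight_sq (k : ℤ) : weight L s k ^ 2 = L * (1 + (k : ℝ) ^ 2) ^ s := by
  have hL : (0 : ℝ) < L := Fact.out
  exact Real.sq_sqrt (by positivity)

/-- Peetre's inequality. It follows from `2 j² + 2 (k - j)² - k² = (k - 2 j)²`. -/
theorem one_add_sq_le (j k : ℝ) : 1 + k ^ 2 ≤ 2 * (1 + j ^ 2) * (1 + (k - j) ^ 2) := by
  nlinarith [sq_nonneg (k - 2 * j), mul_nonneg (sq_nonneg j) (sq_nonneg (k - j))]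

/-- Peetre's inequality produces the factor `(2 (1 + j²))^(s/2)`; the restriction `s ≤ 2` allows it
to be replaced by its base, one bound for all the norms in use. -/
theorem weight_le_mul (hs : s ≤ 2) (j k : ℤ) :
    weight L s k ≤ 2 * (1 + (j : ℝ) ^ 2) * weight L s (k - j) := by
  have hL : (0 : ℝ) < L := Fact.out
  refine (sq_le_sq₀ (weight_pos k).le (mul_nonneg (by positivity) (weight_pos _).le)).1 ?_
  rw [mul_pow, weight_sq, weight_sq, mul_left_comm]
  refine mul_le_mul_of_nonneg_left ?_ hL.le
  have h1 : (1 : ℝ) ≤ 2 * (1 + (j : ℝ) ^ 2) := by nlinarith [sq_nonneg (j : ℝ)]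
  calc (1 + (k : ℝ) ^ 2) ^ s ≤ (2 * (1 + (j : ℝ) ^ 2) * (1 + ((k : ℝ) - j) ^ 2)) ^ s :=
        pow_le_pow_left₀ (by positivity) (one_add_sq_le _ _) s
    _ = (2 * (1 + (j : ℝ) ^ 2)) ^ s * (1 + ((k - j : ℤ) : ℝ) ^ 2) ^ s := by
        rw [mul_pow, Int.cast_sub]
    _ ≤ _ := mul_le_mul_of_nonneg_right (pow_le_pow_right₀ h1 hs) (by positivity)

theorem norm_weightedShift_apply_le (hs : s ≤ 2) (j k : ℤ) (z : ℂ) :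
    ‖(weight L s k / weight L s (k - j)) • z‖ ≤ 2 * (1 + (j : ℝ) ^ 2) * ‖z‖ := by
  rw [norm_smul, Real.norm_of_nonneg (div_nonneg (weight_pos _).le (weight_pos _).le)]
  refine mul_le_mul_of_nonneg_right ?_ (norm_nonneg _)
  rw [div_le_iff₀ (weight_pos _)]
  exact weight_le_mul hs j k

theorem summable_norm_sq (a : lp (fun _ : ℤ => ℂ) 2) : Summable fun k => ‖a k‖ ^ 2 := by
  simpa using (lp.memℓp a).summable (by norm_num)

theorem norm_sq_eq_tsum (a : lp (fun _ : ℤ => ℂ) 2) : ‖a‖ ^ 2 = ∑' k, ‖a k‖ ^ 2 := by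
  simpa using lp.norm_rpow_eq_tsum (p := 2) (by norm_num) a

theorem norm_le_of_apply_le {a b : lp (fun _ : ℤ => ℂ) 2} (h : ∀ k, ‖a k‖ ≤ ‖b k‖) :
    ‖a‖ ≤ ‖b‖ := by
  refine (sq_le_sq₀ (norm_nonneg _) (norm_nonneg _)).1 ?_
  rw [norm_sq_eq_tsum, norm_sq_eq_tsum]
  exact Summable.tsum_le_tsum (fun k => pow_le_pow_left₀ (norm_nonneg _) (h k) 2)
    (summable_norm_sq a) (summable_norm_sq b)

theorem sq_norm_weightedShift_apply_le (hs : s ≤ 2) (j k : ℤ) (z : ℂ) :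
    ‖(weight L s k / weight L s (k - j)) • z‖ ^ 2 ≤ (2 * (1 + (j : ℝ) ^ 2)) ^ 2 * ‖z‖ ^ 2 := by
  rw [← mul_pow]
  exact pow_le_pow_left₀ (norm_nonneg _) (norm_weightedShift_apply_le hs j k z) 2

theorem memℓp_weightedShift (hs : s ≤ 2) (j : ℤ) (a : lp (fun _ : ℤ => ℂ) 2) :
    Memℓp (fun k => (weight L s k / weight L s (k - j)) • a (k - j)) 2 := by
  refine memℓp_gen ?_
  simp only [ENNReal.toReal_ofNat, Real.rpow_ofNat]
  exact Summable.of_nonneg_of_le (fun k => by positivity)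
    (fun k => sq_norm_weightedShift_apply_le hs j k _)
    ((((Equiv.subRight j).summable_iff (f := fun k => ‖a k‖ ^ 2)).2
      (summable_norm_sq a)).mul_left _)

/-- Multiplication by `exp (2 π i j x / L)`, acting on weighted Fourier coefficients. -/
def weightedShift (L : ℝ) [Fact (0 < L)] (hs : s ≤ 2) (j : ℤ) :
    lp (fun _ : ℤ => ℂ) 2 →L[ℂ] lp (fun _ : ℤ => ℂ) 2 :=
  LinearMap.mkContinuous
    { toFun := fun a =>
        ⟨fun k => (weight L s k / weight L s (k - j)) • a (k - j), memℓp_weightedShift hs j a⟩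
      map_add' := fun a b => by
        ext k
        exact smul_add _ _ _
      map_smul' := fun c a => by
        ext k
        exact smul_comm (weight L s k / weight L s (k - j)) c (a (k - j)) }
    (2 * (1 + (j : ℝ) ^ 2)) fun a => by
      refine (sq_le_sq₀ (norm_nonneg _) (by positivity)).1 ?_
      rw [mul_pow, norm_sq_eq_tsum, norm_sq_eq_tsum,
        ← (Equiv.subRight j).tsum_eq (fun k => ‖a k‖ ^ 2), ← tsum_mul_left]
      exact Summable.tsum_le_tsum (fun k => sq_norm_weightedShift_apply_le hs j k _)
        (summable_norm_sq _)
        ((((Equiv.subRight j).summable_iff (f := fun k => ‖a k‖ ^ 2)).2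
          (summable_norm_sq a)).mul_left _)

theorem norm_weightedShift_le (hs : s ≤ 2) (j : ℤ) :
    ‖weightedShift L hs j‖ ≤ 2 * (1 + (j : ℝ) ^ 2) :=
  LinearMap.mkContinuous_norm_le _ (by positivity) _

theorem summable_inv_one_add_sq : Summable fun k : ℤ => (1 + (k : ℝ) ^ 2)⁻¹ := by
  refine Summable.of_norm_bounded_eventually (g := fun k : ℤ => 1 / (k : ℝ) ^ 2)
    (Real.summable_one_div_int_pow.2 (by norm_num)) ?_
  refine (Set.finite_singleton (0 : ℤ)).subset fun k hk => ?_
  by_contra hne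
  refine hk ?_
  have hk0 : (0 : ℝ) < (k : ℝ) ^ 2 := by
    have : (k : ℝ) ≠ 0 := by exact_mod_cast hne
    positivity
  change ‖(1 + (k : ℝ) ^ 2)⁻¹‖ ≤ 1 / (k : ℝ) ^ 2
  rw [Real.norm_of_nonneg (by positivity), one_div]
  exact inv_anti₀ hk0 (by linarith)

/-- The square summable sequence dual to the weights of `H³` in the Wiener type estimate. -/
def wienerSeq (L : ℝ) [Fact (0 < L)] : lp (fun _ : ℤ => ℂ) 2 :=
  ⟨fun k => ((2 * (1 + (k : ℝ) ^ 2) / weight L 3 k : ℝ) : ℂ), memℓp_gen (by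
    have hL : (0 : ℝ) < L := Fact.out
    simp only [ENNReal.toReal_ofNat, Real.rpow_ofNat, Complex.norm_real, Real.norm_eq_abs, sq_abs,
      div_pow, weight_sq]
    refine (summable_inv_one_add_sq.mul_left (4 / L)).congr fun k => ?_
    field_simp
    ring)⟩

/-- Cauchy–Schwarz against the `H³` weights: `(1 + j²) (1 + j²)^(-3/2) = (1 + j²)^(-1/2)` is square
summable. -/
theorem wiener_estimate (f : HperM L 3) :
    (Summable fun j : ℤ => ‖fhat f.toL2 j‖ * (2 * (1 + (j : ℝ) ^ 2))) ∧
      ∑' j : ℤ, ‖fhat f.toL2 j‖ * (2 * (1 + (j : ℝ) ^ 2)) ≤ ‖wienerSeq L‖ * ‖f‖ := by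
  have h := lp.tsum_mul_le_mul_norm (p := 2) (q := 2)
    (by simpa using Real.HolderConjugate.two_two) (HperM.weighted f) (wienerSeq L)
  have heq : ∀ j : ℤ, ‖HperM.weighted f j‖ * ‖wienerSeq L j‖ =
      ‖fhat f.toL2 j‖ * (2 * (1 + (j : ℝ) ^ 2)) := by
    intro j
    have hw := weight_pos (L := L) (s := 3) j
    have h1 : HperM.weighted f j = weight L 3 j • fhat f.toL2 j := rfl
    have h2 : wienerSeq L j = ((2 * (1 + (j : ℝ) ^ 2) / weight L 3 j : ℝ) : ℂ) := rfl
    rw [h1, h2, norm_smul, Real.norm_of_nonneg hw.le, Complex.norm_real,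
      Real.norm_of_nonneg (by positivity)]
    field_simp
  simp only [heq] at h
  rw [mul_comm]
  exact h

theorem norm_smul_weightedShift_le (hs : s ≤ 2) (f : HperM L 3) (j : ℤ) :
    ‖fhat f.toL2 j • weightedShift L hs j‖ ≤ ‖fhat f.toL2 j‖ * (2 * (1 + (j : ℝ) ^ 2)) := by
  rw [norm_smul]
  exact mul_le_mul_of_nonneg_left (norm_weightedShift_le hs j) (norm_nonneg _)

theorem summable_smul_weightedShift (hs : s ≤ 2) (f : HperM L 3) :
    Summable fun j : ℤ => fhat f.toL2 j • weightedShift L hs j :=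
  Summable.of_norm_bounded (wiener_estimate f).1 (norm_smul_weightedShift_le hs f)

/-- Multiplication by a function in `H³`, acting on weighted Fourier coefficients. -/
def mulOp (hs : s ≤ 2) (f : HperM L 3) : lp (fun _ : ℤ => ℂ) 2 →L[ℂ] lp (fun _ : ℤ => ℂ) 2 :=
  ∑' j : ℤ, fhat f.toL2 j • weightedShift L hs j

theorem norm_mulOp_le (hs : s ≤ 2) (f : HperM L 3) : ‖mulOp hs f‖ ≤ ‖wienerSeq L‖ * ‖f‖ :=
  (tsum_of_norm_bounded (wiener_estimate f).1.hasSum (norm_smul_weightedShift_le hs f)).trans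
    (wiener_estimate f).2

theorem hasSum_mulOp_apply (hs : s ≤ 2) (f : HperM L 3) (a : lp (fun _ : ℤ => ℂ) 2) (k : ℤ) :
    HasSum (fun j : ℤ =>
      fhat f.toL2 j * ((weight L s k / weight L s (k - j)) • a (k - j))) (mulOp hs f a k) := by
  have h := (summable_smul_weightedShift hs f).hasSum
  have h1 := h.mapL (ContinuousLinearMap.apply ℂ (lp (fun _ : ℤ => ℂ) 2) a)
  have h2 := h1.mapL (lp.evalCLM ℂ (fun _ : ℤ => ℂ) 2 k)
  exact h2

/-- The Fourier series converges absolutely, so it has a continuous sum; uniqueness of the `L²`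
limit identifies that sum with `f` almost everywhere. Boundedness is what puts the pointwise
products in `L²`. -/
theorem exists_ae_bound (f : HperM L 3) : ∃ M : ℝ, ∀ᵐ x : AddCircle L, |f.toL2 x| ≤ M := by
  have hsum : Summable fun j : ℤ => fhat f.toL2 j := by
    refine Summable.of_norm_bounded (wiener_estimate f).1 fun j => ?_
    exact le_mul_of_one_le_right (norm_nonneg _) (by nlinarith [sq_nonneg (j : ℝ)])
  have hC : Summable fun j : ℤ => fhat f.toL2 j • (fourier j : C(AddCircle L, ℂ)) := by
    refine Summable.of_norm ?_
    simpa [norm_smul, fourier_norm] using hsum.norm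
  obtain ⟨F, hF⟩ := hC
  set Fc := (memLp_ofReal f.toL2).toLp _ with hFc
  have h1 := hasSum_fourier_series_L2 Fc
  have h2 := hF.mapL (ContinuousMap.toLp (E := ℂ) 2 AddCircle.haarAddCircle ℂ)
  have hco : ∀ j, fourierCoeff (Fc : AddCircle L → ℂ) j = fhat f.toL2 j := fun j => by
    rw [fourierCoeff_congr_ae (memLp_ofReal f.toL2).coeFn_toLp]
    rfl
  simp only [hco] at h1
  simp only [map_smul] at h2
  have heq : ContinuousMap.toLp (E := ℂ) 2 AddCircle.haarAddCircle ℂ F = Fc := h2.unique h1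
  refine ⟨‖F‖, ae_of_ae_haar ?_⟩
  filter_upwards [(memLp_ofReal f.toL2).coeFn_toLp,
    ContinuousMap.coeFn_toLp (p := 2) (𝕜 := ℂ) AddCircle.haarAddCircle F] with x hx1 hx2
  rw [heq, hFc, hx1] at hx2
  have h3 := F.norm_coe_le_norm x
  rw [← hx2] at h3
  simpa using h3

theorem memLp_mul (f : HperM L 3) (g : L2per L) :
    MemLp (fun x : AddCircle L => f.toL2 x * g x) 2 volume := by
  obtain ⟨M, hM⟩ := exists_ae_bound f
  refine MemLp.of_le_mul (c := M) (Lp.memLp g)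
    ((Lp.aestronglyMeasurable f.toL2).mul (Lp.aestronglyMeasurable g)) ?_
  filter_upwards [hM] with x hx
  rw [norm_mul]
  exact mul_le_mul_of_nonneg_right hx (norm_nonneg _)

/-- The product of a function in `H³_{per,m}` and a function in `L²_per`. -/
def mulL2 (f : HperM L 3) (g : L2per L) : L2per L := (memLp_mul f g).toLp _

theorem coeFn_mulL2 (f : HperM L 3) (g : L2per L) :
    ∀ᵐ x : AddCircle L, mulL2 f g x = f.toL2 x * g x :=
  (memLp_mul f g).coeFn_toLp

/-- The Fourier coefficients of a product. -/
theorem hasSum_fhat_mulL2 (f : HperM L 3) (g : L2per L) (k : ℤ) :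
    HasSum (fun j : ℤ => fhat f.toL2 j * fhat g (k - j)) (fhat (mulL2 f g) k) := by
  -- Pairing with `e_k g`, where `g` is real, is a continuous functional on `L²`. It sends `f` to
  -- the coefficient `k` of `f g` and `e_j` to `ĝ(k - j)`, so the convolution formula is its value
  -- on the Fourier series of `f`.
  have hGmem : MemLp (fun x : AddCircle L => fourier k x * ((g x : ℝ) : ℂ)) 2
      AddCircle.haarAddCircle := by
    refine MemLp.of_le_mul (c := 1) (memLp_ofReal g)
      ((map_continuous (fourier k)).aestronglyMeasurable.mul
        (memLp_ofReal g).aestronglyMeasurable) ?_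
    refine Eventually.of_forall fun x => ?_
    rw [norm_mul, fourier_apply, Circle.norm_coe]
  set Fc := (memLp_ofReal f.toL2).toLp _ with hFc
  have hco : ∀ j, fourierCoeff (Fc : AddCircle L → ℂ) j = fhat f.toL2 j := fun j => by
    rw [fourierCoeff_congr_ae (memLp_ofReal f.toL2).coeFn_toLp]
    rfl
  have h1 := (hasSum_fourier_series_L2 Fc).mapL (innerSL ℂ (hGmem.toLp _))
  simp only [hco, map_smul, innerSL_apply_apply, smul_eq_mul] at h1
  have hterm : ∀ j, fhat g (k - j) = inner ℂ (hGmem.toLp _) (fourierLp (T := L) 2 j) := by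
    intro j
    rw [L2.inner_def]
    unfold fhat fourierCoeff
    refine integral_congr_ae ?_
    filter_upwards [hGmem.coeFn_toLp, coeFn_fourierLp (T := L) 2 j] with x hx1 hx2
    rw [hx1, hx2, RCLike.inner_apply, map_mul, Complex.conj_ofReal, ← fourier_neg, neg_sub,
      sub_eq_add_neg, fourier_add, smul_eq_mul]
    ring
  have hlim : fhat (mulL2 f g) k = inner ℂ (hGmem.toLp _) Fc := by
    rw [L2.inner_def]
    unfold fhat fourierCoeff
    refine integral_congr_ae ?_
    filter_upwards [hGmem.coeFn_toLp, (memLp_ofReal f.toL2).coeFn_toLp,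
      ae_haar_of_ae (coeFn_mulL2 f g)] with x hx1 hx2 hx3
    rw [hx1, hFc, hx2, hx3, RCLike.inner_apply, map_mul, Complex.conj_ofReal, ← fourier_neg,
      smul_eq_mul]
    push_cast
    ring
  simp only [hterm, hlim]
  exact h1

/-- `a` is the sequence of weighted Fourier coefficients of `g`. -/
def HasWeighted (s : ℕ) (g : L2per L) (a : lp (fun _ : ℤ => ℂ) 2) : Prop :=
  ∀ k, a k = weight L s k • fhat g k

/-- Identifies the operator on sequences with the pointwise product: the weights at `k - j` cancel
and leave the convolution. The relation `HasWeighted` allows a nonzero mean, as products of mean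
zero functions may have one. -/
theorem HasWeighted.mul (hs : s ≤ 2) (f : HperM L 3) {g : L2per L} {a : lp (fun _ : ℤ => ℂ) 2}
    (h : HasWeighted s g a) : HasWeighted s (mulL2 f g) (mulOp hs f a) := by
  intro k
  refine (hasSum_mulOp_apply hs f a k).unique ?_
  have h1 := (hasSum_fhat_mulL2 f g k).const_smul (weight L s k)
  convert h1 using 1
  funext j
  have hw := (weight_pos (L := L) (s := s) (k - j)).ne'
  rw [h, smul_smul, div_mul_cancel₀ _ hw, mul_smul_comm]

theorem HasWeighted.add {g h : L2per L} {a b : lp (fun _ : ℤ => ℂ) 2}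
    (hg : HasWeighted s g a) (hh : HasWeighted s h b) : HasWeighted s (g + h) (a + b) := by
  intro k
  rw [fhat_add, smul_add, ← hg, ← hh]
  rfl

theorem HasWeighted.sub {g h : L2per L} {a b : lp (fun _ : ℤ => ℂ) 2}
    (hg : HasWeighted s g a) (hh : HasWeighted s h b) : HasWeighted s (g - h) (a - b) := by
  intro k
  rw [fhat_sub, smul_sub, ← hg, ← hh]
  rfl

theorem hasWeighted_weighted (f : HperM L s) : HasWeighted s f.toL2 (HperM.weighted f) :=
  fun _ => rfl

theorem HasWeighted.mem_hper {g : L2per L} {a : lp (fun _ : ℤ => ℂ) 2} (h : HasWeighted s g a) :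
    g ∈ hper L s := by
  have hL : (0 : ℝ) < L := Fact.out
  change Summable _
  refine ((summable_norm_sq a).mul_left L⁻¹).congr fun k => ?_
  rw [h, weight, HperM.sq_weighted, inv_mul_cancel_left₀ hL.ne']

/-- The zero mode of `f` vanishes, so `g` may differ from it by a constant. This removes the
nonlocal mean term from the estimates. -/
theorem HperM.norm_le_of_hasWeighted {f : HperM L s} {g : L2per L} {a : lp (fun _ : ℤ => ℂ) 2}
    (h : HasWeighted s g a) (hfg : ∀ k ≠ 0, fhat f.toL2 k = fhat g k) : ‖f‖ ≤ ‖a‖ := by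
  rw [← HperM.norm_weighted]
  refine norm_le_of_apply_le fun k => ?_
  rcases eq_or_ne k 0 with rfl | hk
  · rw [HperM.weighted_apply, HperM.fhat_toL2_zero, smul_zero, norm_zero]
    exact norm_nonneg _
  · rw [HperM.weighted_apply, hfg k hk, h]
    rfl

/-- The constant function. -/
def constL2 (L : ℝ) [Fact (0 < L)] (c : ℝ) : L2per L := (memLp_const c).toLp _

theorem coeFn_constL2 (c : ℝ) : ∀ᵐ x : AddCircle L, constL2 L c x = c :=
  (memLp_const c).coeFn_toLp

theorem fhat_constL2 (c : ℝ) {k : ℤ} (hk : k ≠ 0) : fhat (constL2 L c) k = 0 := by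
  unfold fhat
  have h1 : (fun x : AddCircle L => ((constL2 L c x : ℝ) : ℂ))
      =ᵐ[AddCircle.haarAddCircle (T := L)] fun x => (c : ℂ) * fourier 0 x := by
    filter_upwards [ae_haar_of_ae (coeFn_constL2 (L := L) c)] with x hx
    rw [hx, fourier_zero, mul_one]
  rw [fourierCoeff_congr_ae h1, fourierCoeff.const_mul, fourierCoeff_fourier,
    Pi.single_eq_of_ne hk, mul_zero]

theorem constL2_mem_hper (c : ℝ) : constL2 L c ∈ hper L s := by
  change Summable _
  refine summable_of_ne_finset_zero (s := {0}) fun k hk => ?_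
  rw [fhat_constL2 c (by simpa using hk)]
  simp

/-! ### The cubic nonlinearity and its Lipschitz estimate -/

section Nonlinearity

/-- The cube of a function in `H³_{per,m}`. -/
def cubeL2 (f : HperM L 3) : L2per L := mulL2 f (mulL2 f f.toL2)

theorem coeFn_cubeL2 (f : HperM L 3) : ∀ᵐ x : AddCircle L, cubeL2 f x = f.toL2 x ^ 3 := by
  filter_upwards [coeFn_mulL2 f (mulL2 f f.toL2), coeFn_mulL2 f f.toL2] with x h1 h2
  rw [cubeL2, h1, h2]
  ring

theorem cubeL2_mem_hper (hs : s ≤ 2) (f : HperM L 3) : cubeL2 f ∈ hper L s :=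
  (((hasWeighted_weighted (HperM.incl (hs.trans (by norm_num)) f)).mul hs f).mul hs f).mem_hper

theorem integral_cubeL2 (f : HperM L 3) :
    ∫ x : AddCircle L, cubeL2 f x = ∫ x : AddCircle L, f.toL2 x ^ 3 :=
  integral_congr_ae (coeFn_cubeL2 f)

/-- The nonlinearity `φ - φ³ + (1 / L) ∫₀ᴸ φ³ dx`, as an element of `L²`. -/
def nonlinL2 (f : HperM L 3) : L2per L :=
  f.toL2 - cubeL2 f + constL2 L (1 / L * ∫ x : AddCircle L, f.toL2 x ^ 3)

theorem coeFn_nonlinL2 (f : HperM L 3) : ∀ᵐ x : AddCircle L, nonlinL2 f x =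
    f.toL2 x - f.toL2 x ^ 3 + 1 / L * ∫ y : AddCircle L, f.toL2 y ^ 3 := by
  filter_upwards [coeFn_cubeL2 f, coeFn_constL2 (L := L) (1 / L * ∫ x : AddCircle L, f.toL2 x ^ 3),
    Lp.coeFn_add (f.toL2 - cubeL2 f) (constL2 L (1 / L * ∫ x : AddCircle L, f.toL2 x ^ 3)),
    Lp.coeFn_sub f.toL2 (cubeL2 f)] with x h1 h2 h3 h4
  rw [nonlinL2, h3, Pi.add_apply, h4, Pi.sub_apply, h1, h2]

theorem nonlinL2_mem_zeroMean (f : HperM L 3) : nonlinL2 f ∈ zeroMean L := by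
  have hL : (0 : ℝ) < L := Fact.out
  rw [mem_zeroMean_iff, nonlinL2, fhat_add, fhat_sub, HperM.fhat_toL2_zero, fhat_zero_eq_integral,
    fhat_zero_eq_integral, integral_cubeL2, integral_congr_ae (coeFn_constL2 _), integral_const,
    measureReal_def, AddCircle.measure_univ, ENNReal.toReal_ofReal hL.le, smul_eq_mul,
    ← mul_assoc (1 / L) L, one_div_mul_cancel hL.ne', one_mul, zero_sub, neg_add_cancel]

/-- The nonlinearity `φ - φ³ + (1 / L) ∫₀ᴸ φ³ dx`, as a map from `H³_{per,m}` to `H²_{per,m}`. -/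
def nonlin (f : HperM L 3) : HperM L 2 :=
  ⟨nonlinL2 f, add_mem (sub_mem (hper_mono L (by norm_num) f.mem_hper)
    (cubeL2_mem_hper le_rfl f)) (constL2_mem_hper _), nonlinL2_mem_zeroMean f⟩

/-- The factorization of `f³ - g³`, with `f - g` innermost: it is the factor measured in `H^s`,
while the outer ones act as multipliers from `H³`. -/
theorem cubeL2_sub (f g : HperM L 3) : cubeL2 f - cubeL2 g =
    mulL2 f (mulL2 f (f - g).toL2) + mulL2 f (mulL2 g (f - g).toL2)
      + mulL2 g (mulL2 g (f - g).toL2) := by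
  apply Lp.ext
  set d := (f - g).toL2 with hd
  have hd' : d = f.toL2 - g.toL2 := rfl
  filter_upwards [coeFn_cubeL2 f, coeFn_cubeL2 g, Lp.coeFn_sub (cubeL2 f) (cubeL2 g),
    Lp.coeFn_add (mulL2 f (mulL2 f d) + mulL2 f (mulL2 g d)) (mulL2 g (mulL2 g d)),
    Lp.coeFn_add (mulL2 f (mulL2 f d)) (mulL2 f (mulL2 g d)),
    coeFn_mulL2 f (mulL2 f d), coeFn_mulL2 f (mulL2 g d), coeFn_mulL2 g (mulL2 g d),
    coeFn_mulL2 f d, coeFn_mulL2 g d, Lp.coeFn_sub f.toL2 g.toL2]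
    with x h1 h2 h3 h4 h5 h6 h7 h8 h9 h10 h11
  rw [← hd'] at h11
  rw [h3, h4, Pi.add_apply, h5, Pi.add_apply, Pi.sub_apply, h1, h2, h6, h7, h8, h9, h10, h11,
    Pi.sub_apply]
  ring

theorem norm_mulOp_mulOp_le (hs : s ≤ 2) (f g : HperM L 3) (a : lp (fun _ : ℤ => ℂ) 2) :
    ‖mulOp hs f (mulOp hs g a)‖ ≤ ‖wienerSeq L‖ ^ 2 * (‖f‖ * ‖g‖) * ‖a‖ := by
  calc ‖mulOp hs f (mulOp hs g a)‖ ≤ (‖wienerSeq L‖ * ‖f‖) * ((‖wienerSeq L‖ * ‖g‖) * ‖a‖) :=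
        ((mulOp hs f).le_of_opNorm_le (norm_mulOp_le hs f) _).trans
          (mul_le_mul_of_nonneg_left
            ((mulOp hs g).le_of_opNorm_le (norm_mulOp_le hs g) _) (by positivity))
    _ = _ := by ring

/-- The nonlinearity is Lipschitz for the norm of `H^s`, `s ≤ 2`, on bounded sets of `H³`. -/
theorem norm_nonlin_sub_le (hs : s ≤ 2) {f g : HperM L 3} {R : ℝ} (hf : ‖f‖ ≤ R) (hg : ‖g‖ ≤ R) :
    ‖HperM.incl hs (nonlin f) - HperM.incl hs (nonlin g)‖ ≤
      (1 + 3 * (‖wienerSeq L‖ ^ 2 * R ^ 2)) *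
        ‖HperM.incl (hs.trans (by norm_num : 2 ≤ 3)) (f - g)‖ := by
  set d := HperM.incl (hs.trans (by norm_num : 2 ≤ 3)) (f - g) with hd
  set a := HperM.weighted d with ha
  have hw : HasWeighted s (f - g).toL2 a := hasWeighted_weighted d
  have h := hw.sub ((((hw.mul hs f).mul hs f).add ((hw.mul hs g).mul hs f)).add
    ((hw.mul hs g).mul hs g))
  rw [← cubeL2_sub] at h
  have hR : 0 ≤ R := (norm_nonneg _).trans hf
  refine (HperM.norm_le_of_hasWeighted h fun k hk => ?_).trans ?_
  · rw [HperM.toL2_sub, HperM.toL2_incl, HperM.toL2_incl]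
    change fhat (nonlinL2 f - nonlinL2 g) k = _
    simp only [nonlinL2, HperM.toL2_sub, fhat_sub, fhat_add, fhat_constL2 _ hk]
    ring
  -- In the constant, `1` comes from the linear term and `3` from the three products in `f³ - g³`.
  · have hprod : ∀ p q : HperM L 3, ‖p‖ ≤ R → ‖q‖ ≤ R →
        ‖mulOp hs p (mulOp hs q a)‖ ≤ ‖wienerSeq L‖ ^ 2 * R ^ 2 * ‖a‖ := fun p q hp hq => by
      refine (norm_mulOp_mulOp_le hs p q a).trans ?_
      have : ‖p‖ * ‖q‖ ≤ R ^ 2 := by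
        rw [pow_two]
        exact mul_le_mul hp hq (norm_nonneg _) hR
      gcongr
    have h1 : ‖a‖ = ‖d‖ := HperM.norm_weighted d
    have h2 := norm_sub_le a (mulOp hs f (mulOp hs f a) + mulOp hs f (mulOp hs g a)
      + mulOp hs g (mulOp hs g a))
    have h3 := norm_add₃_le (a := mulOp hs f (mulOp hs f a)) (b := mulOp hs f (mulOp hs g a))
      (c := mulOp hs g (mulOp hs g a))
    have h4 := hprod f f hf hf
    have h5 := hprod f g hf hg
    have h6 := hprod g g hg hg
    rw [← h1]
    linarith

end Nonlinearity

end PerSobolev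

end

/-! ### Strongly continuous families of operators -/

noncomputable section

namespace PerSobolev

open Filter Topology ComplexConjugate

section OperatorFamilies

variable {E G : Type*} [NormedAddCommGroup E] [NormedSpace ℝ E] [NormedAddCommGroup G]
  [NormedSpace ℝ G]

/-- A uniformly bounded, strongly convergent family of operators applied to a convergent family. -/
theorem tendsto_clm_apply {ι : Type*} {l : Filter ι} {A : ι → E →L[ℝ] G} {C : ℝ}
    (hA : ∀ i x, ‖A i x‖ ≤ C * ‖x‖) {y : ι → E} {y₀ : E} {z : G} (hy : Tendsto y l (𝓝 y₀))
    (hz : Tendsto (fun i => A i y₀) l (𝓝 z)) : Tendsto (fun i => A i (y i)) l (𝓝 z) := by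
  have h1 : Tendsto (fun i => A i (y i - y₀)) l (𝓝 0) := by
    refine squeeze_zero_norm (fun i => hA i _) ?_
    have h2 := (hy.sub_const y₀).norm.const_mul C
    simpa using h2
  simpa [map_sub] using h1.add hz

/-- A product rule that does not need differentiability of `A` in operator norm. The slope splits
into that of `A τ (y t)` and `A τ` applied to the slope of `y`; the uniform bound and strong
continuity handle the latter. -/
theorem hasDerivWithinAt_clm_apply {A : ℝ → E →L[ℝ] G} {C : ℝ}
    (hA : ∀ t x, ‖A t x‖ ≤ C * ‖x‖) (hc : ∀ x, Continuous fun t => A t x) {y : ℝ → E} {y' : E}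
    {z : G} {S : Set ℝ} {t : ℝ} (hy : HasDerivWithinAt y y' S t)
    (hz : HasDerivWithinAt (fun τ => A τ (y t)) z S t) :
    HasDerivWithinAt (fun τ => A τ (y τ)) (z + A t y') S t := by
  rw [hasDerivWithinAt_iff_tendsto_slope] at hy hz ⊢
  have h1 : Tendsto (fun τ => A τ (slope y t τ)) (𝓝[S \ {t}] t) (𝓝 (A t y')) :=
    tendsto_clm_apply hA hy (((hc y').tendsto t).mono_left nhdsWithin_le_nhds)
  refine (hz.add h1).congr fun τ => ?_
  rw [slope_def_module, slope_def_module, slope_def_module, map_smul, ← smul_add, map_sub]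
  congr 1
  abel

theorem continuousOn_clm_apply {A : ℝ → E →L[ℝ] G} {C : ℝ} (hA : ∀ t x, ‖A t x‖ ≤ C * ‖x‖)
    (hc : ∀ x, Continuous fun t => A t x) {y : ℝ → E} {S : Set ℝ} (hy : ContinuousOn y S) :
    ContinuousOn (fun t => A t (y t)) S := fun t ht =>
  tendsto_clm_apply hA (hy t ht) (((hc (y t)).tendsto t).mono_left nhdsWithin_le_nhds)

end OperatorFamilies

/-! ### The operators `cos (t |∂ₓ|)`, `sin (t |∂ₓ|)`, `|∂ₓ|` and its inverse -/

/-- The frequency `2 π |k| / L`. -/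
def freq (L : ℝ) (k : ℤ) : ℝ := 2 * Real.pi / L * |(k : ℝ)|

theorem freq_neg {L : ℝ} (k : ℤ) : freq L (-k) = freq L k := by simp [freq]

theorem freq_sq {L : ℝ} (k : ℤ) : freq L k ^ 2 = (2 * Real.pi / L) ^ 2 * (k : ℝ) ^ 2 := by
  rw [freq, mul_pow, sq_abs]

variable {L : ℝ} [Fact (0 < L)] {r s : ℕ}

theorem freq_nonneg (k : ℤ) : 0 ≤ freq L k := by
  have hL : (0 : ℝ) < L := Fact.out
  have := Real.pi_pos
  unfold freq
  positivity

theorem freq_ne_zero {k : ℤ} (hk : k ≠ 0) : freq L k ≠ 0 := by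
  have hL : (0 : ℝ) < L := Fact.out
  have := Real.pi_pos
  have hk' : (k : ℝ) ≠ 0 := by exact_mod_cast hk
  unfold freq
  positivity

namespace HperM

/-- The operator `cos (t |∂ₓ|)`. -/
def cosOp (t : ℝ) : HperM L s →L[ℝ] HperM L s :=
  multiplier (fun k => Real.cos (t * freq L k)) (fun k => by rw [freq_neg]) 1 zero_le_one
    fun k _ => by
      rw [one_pow, one_mul]
      exact mul_le_of_le_one_right (by positivity) (Real.cos_sq_le_one _)

/-- The operator `sin (t |∂ₓ|)`. -/
def sinOp (t : ℝ) : HperM L s →L[ℝ] HperM L s :=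
  multiplier (fun k => Real.sin (t * freq L k)) (fun k => by rw [freq_neg]) 1 zero_le_one
    fun k _ => by
      rw [one_pow, one_mul]
      exact mul_le_of_le_one_right (by positivity) (Real.sin_sq_le_one _)

/-- The operator `|∂ₓ|`. -/
def absD (h : r + 1 ≤ s) : HperM L s →L[ℝ] HperM L r :=
  multiplier (freq L) freq_neg (2 * Real.pi / L)
    (div_nonneg (by positivity) (Fact.out : (0 : ℝ) < L).le) fun k _ => by
      rw [freq_sq, mul_left_comm]
      refine mul_le_mul_of_nonneg_left ?_ (by positivity)
      have h1 : (1 : ℝ) ≤ 1 + (k : ℝ) ^ 2 := by nlinarith [sq_nonneg (k : ℝ)]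
      calc (1 + (k : ℝ) ^ 2) ^ r * (k : ℝ) ^ 2 ≤ (1 + (k : ℝ) ^ 2) ^ r * (1 + (k : ℝ) ^ 2) := by
            gcongr
            linarith
        _ = (1 + (k : ℝ) ^ 2) ^ (r + 1) := (pow_succ _ _).symm
        _ ≤ _ := pow_le_pow_right₀ h1 h

/-- The inverse of `|∂ₓ|` on mean zero functions. -/
def absDInv (h : s ≤ r + 1) : HperM L r →L[ℝ] HperM L s :=
  multiplier (fun k => (freq L k)⁻¹) (fun k => by rw [freq_neg]) (L / Real.pi)
    (div_nonneg (Fact.out : (0 : ℝ) < L).le Real.pi_pos.le) fun k hk => by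
      have hL : (0 : ℝ) < L := Fact.out
      have hpi := Real.pi_pos
      have h1 : (1 : ℝ) ≤ 1 + (k : ℝ) ^ 2 := by nlinarith [sq_nonneg (k : ℝ)]
      have hk1 : (1 : ℝ) ≤ (k : ℝ) ^ 2 := by
        have h2 : (1 : ℤ) ≤ k ^ 2 := by
          have := sq_nonneg k
          have : k ^ 2 ≠ 0 := pow_ne_zero 2 hk
          omega
        exact_mod_cast h2
      rw [inv_pow, freq_sq, mul_inv_le_iff₀ (by positivity)]
      calc (1 + (k : ℝ) ^ 2) ^ s ≤ (1 + (k : ℝ) ^ 2) ^ (r + 1) := pow_le_pow_right₀ h1 h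
        _ = (1 + (k : ℝ) ^ 2) ^ r * (1 + (k : ℝ) ^ 2) := pow_succ _ _
        -- For `k ≠ 0` one has `1 + k² ≤ 4 k² = (L / π)² (freq L k)²`, which explains the constant
        -- `L / π`.
        _ ≤ (1 + (k : ℝ) ^ 2) ^ r * (4 * (k : ℝ) ^ 2) := by
            gcongr
            linarith
        _ = _ := by
            field_simp
            ring

theorem fhat_cosOp (t : ℝ) (f : HperM L s) (k : ℤ) :
    fhat (cosOp t f).toL2 k = Real.cos (t * freq L k) • fhat f.toL2 k := fhat_multiplier f k

theorem fhat_sinOp (t : ℝ) (f : HperM L s) (k : ℤ) :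
    fhat (sinOp t f).toL2 k = Real.sin (t * freq L k) • fhat f.toL2 k := fhat_multiplier f k

theorem fhat_absD (h : r + 1 ≤ s) (f : HperM L s) (k : ℤ) :
    fhat (absD h f).toL2 k = freq L k • fhat f.toL2 k := fhat_multiplier f k

theorem fhat_absDInv (h : s ≤ r + 1) (f : HperM L r) (k : ℤ) :
    fhat (absDInv h f).toL2 k = (freq L k)⁻¹ • fhat f.toL2 k := fhat_multiplier f k

theorem norm_cosOp_le (t : ℝ) (f : HperM L s) : ‖cosOp t f‖ ≤ ‖f‖ :=
  (norm_multiplier_le f).trans_eq (one_mul _)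

theorem norm_sinOp_le (t : ℝ) (f : HperM L s) : ‖sinOp t f‖ ≤ ‖f‖ :=
  (norm_multiplier_le f).trans_eq (one_mul _)

/-- The symbols are inverse to each other off `k = 0`, and mean zero makes both sides vanish at `k =
0`. -/
theorem absDInv_absD (h : r + 1 ≤ s) {s' : ℕ} (h' : s' ≤ r + 1) (f : HperM L s) :
    absDInv h' (absD h f) = inclCLM (h'.trans h) f := ext_fhat fun k => by
  rw [fhat_absDInv, fhat_absD, toL2_inclCLM]
  rcases eq_or_ne k 0 with rfl | hk
  · simp [fhat_toL2_zero]
  · exact inv_smul_smul₀ (freq_ne_zero hk) _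

theorem absD_absDInv (h : s ≤ r + 1) {r' : ℕ} (h' : r' + 1 ≤ s) (f : HperM L r) :
    absD h' (absDInv h f) = inclCLM (by omega) f := ext_fhat fun k => by
  rw [fhat_absD, fhat_absDInv, toL2_inclCLM]
  rcases eq_or_ne k 0 with rfl | hk
  · simp [fhat_toL2_zero]
  · exact smul_inv_smul₀ (freq_ne_zero hk) _

/-- For symbols bounded by one and continuous in a parameter, the multipliers are strongly
continuous. -/
theorem continuous_of_symbol {m : ℝ → ℤ → ℝ} (hm : ∀ k, Continuous fun t => m t k)
    (hm1 : ∀ t k, m t k ^ 2 ≤ 1) {f : HperM L s} {F : ℝ → HperM L s}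
    (hF : ∀ t k, fhat (F t).toL2 k = m t k • fhat f.toL2 k) : Continuous F := by
  refine continuous_iff_continuousAt.2 fun t => tendsto_of_coeff f.summable_weighted (fun k => ?_)
    (Eventually.of_forall fun τ k => ?_)
  · simp only [hF]
    exact ((hm k).tendsto t).smul_const _
  · rw [hF, norm_smul, mul_pow, Real.norm_eq_abs, sq_abs]
    gcongr
    exact mul_le_of_le_one_left (by positivity) (hm1 τ k)

theorem continuous_cosOp (f : HperM L s) : Continuous fun t => cosOp t f :=
  continuous_of_symbol (m := fun t k => Real.cos (t * freq L k))
    (fun k => by fun_prop) (fun _ _ => Real.cos_sq_le_one _) fun t k => fhat_cosOp t f k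

theorem continuous_sinOp (f : HperM L s) : Continuous fun t => sinOp t f :=
  continuous_of_symbol (m := fun t k => Real.sin (t * freq L k))
    (fun k => by fun_prop) (fun _ _ => Real.sin_sq_le_one _) fun t k => fhat_sinOp t f k

/-- For symbols whose derivative in a parameter is bounded by the frequency, the multipliers are
differentiable with the loss of one space derivative. -/
theorem hasDerivAt_of_symbol (h : r + 1 ≤ s) {m : ℝ → ℤ → ℝ} {m' : ℤ → ℝ} {t : ℝ}
    (hm : ∀ k, HasDerivAt (fun τ => m τ k) (m' k * freq L k) t)
    (hm1 : ∀ τ k, |m τ k - m t k| ≤ freq L k * |τ - t|) {f : HperM L s} {F : ℝ → HperM L r}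
    {G : HperM L r} (hF : ∀ τ k, fhat (F τ).toL2 k = m τ k • fhat f.toL2 k)
    (hG : ∀ k, fhat G.toL2 k = m' k • fhat (absD h f).toL2 k) : HasDerivAt F G t := by
  refine hasDerivAt_of_coeff (absD h f).summable_weighted (fun k => ?_) fun τ k => ?_
  · simp only [hF, hG, fhat_absD, smul_smul]
    exact (hm k).smul_const _
  · rw [hF, hF, ← sub_smul, fhat_absD, norm_smul, norm_smul, mul_pow, mul_pow, Real.norm_eq_abs,
      Real.norm_eq_abs, sq_abs (freq L k), mul_assoc, mul_right_comm (freq L k ^ 2)]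
    gcongr
    rw [← sq_abs (τ - t), ← mul_pow]
    exact pow_le_pow_left₀ (abs_nonneg _) (hm1 τ k) 2

theorem hasDerivAt_cosOp (h : r + 1 ≤ s) (f : HperM L s) (t : ℝ) :
    HasDerivAt (fun τ => cosOp τ (inclCLM (Nat.le_of_succ_le h) f)) (-sinOp t (absD h f)) t := by
  refine hasDerivAt_of_symbol h (m := fun τ k => Real.cos (τ * freq L k))
    (m' := fun k => -Real.sin (t * freq L k)) (fun k => ?_) (fun τ k => ?_)
    (fun τ k => fhat_cosOp τ _ k) fun k => ?_
  · simpa using ((hasDerivAt_id t).mul_const (freq L k)).cos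
  · refine (Real.abs_cos_sub_cos_le _ _).trans_eq ?_
    rw [← sub_mul, abs_mul, abs_of_nonneg (freq_nonneg k), mul_comm]
  · rw [neg_smul, ← fhat_sinOp, ← neg_one_smul ℝ (sinOp t (absD h f)), toL2_smul, fhat_smul,
      neg_one_smul]

theorem hasDerivAt_sinOp (h : r + 1 ≤ s) (f : HperM L s) (t : ℝ) :
    HasDerivAt (fun τ => sinOp τ (inclCLM (Nat.le_of_succ_le h) f)) (cosOp t (absD h f)) t := by
  refine hasDerivAt_of_symbol h (m := fun τ k => Real.sin (τ * freq L k))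
    (m' := fun k => Real.cos (t * freq L k)) (fun k => ?_) (fun τ k => ?_)
    (fun τ k => fhat_sinOp τ _ k) fun k => fhat_cosOp t _ k
  · simpa using ((hasDerivAt_id t).mul_const (freq L k)).sin
  · refine (Real.abs_sin_sub_sin_le _ _).trans_eq ?_
    rw [← sub_mul, abs_mul, abs_of_nonneg (freq_nonneg k), mul_comm]

end HperM

/-! ### The linear wave group -/

open HperM

/-- The group of the linear wave equation in the variables `(|∂ₓ| φ, φ_t)`. -/
def rot (t : ℝ) : (HperM L s × HperM L s) →L[ℝ] (HperM L s × HperM L s) :=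
  ((cosOp t).comp (ContinuousLinearMap.fst ℝ _ _)
    + (sinOp t).comp (ContinuousLinearMap.snd ℝ _ _)).prod
  ((cosOp t).comp (ContinuousLinearMap.snd ℝ _ _)
    - (sinOp t).comp (ContinuousLinearMap.fst ℝ _ _))

theorem rot_apply (t : ℝ) (x : HperM L s × HperM L s) :
    rot t x = (cosOp t x.1 + sinOp t x.2, cosOp t x.2 - sinOp t x.1) := rfl

/-- The generator `(u, v) ↦ (|∂ₓ| v, - |∂ₓ| u)` of the group `rot`. -/
def rotGen (h : r + 1 ≤ s) (x : HperM L s × HperM L s) : HperM L r × HperM L r :=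
  (absD h x.2, -absD h x.1)

/-- The inclusion of `H^s × H^s` into `H^r × H^r`. -/
def inclProd (h : r ≤ s) : (HperM L s × HperM L s) →L[ℝ] (HperM L r × HperM L r) :=
  (inclCLM h).prodMap (inclCLM h)

theorem inclProd_apply (h : r ≤ s) (x : HperM L s × HperM L s) :
    inclProd h x = (inclCLM h x.1, inclCLM h x.2) := rfl

/-- Mode by mode these are the addition formulas for rotations of the plane. -/
theorem rot_add (t τ : ℝ) (x : HperM L s × HperM L s) : rot (t + τ) x = rot t (rot τ x) := by
  simp only [rot_apply]
  refine Prod.ext (ext_fhat fun k => ?_) (ext_fhat fun k => ?_)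
  · simp only [toL2_add, toL2_sub, fhat_add, fhat_sub, fhat_cosOp, fhat_sinOp, add_mul,
      Real.cos_add, Real.sin_add, Complex.real_smul]
    push_cast
    ring
  · simp only [toL2_add, toL2_sub, fhat_add, fhat_sub, fhat_cosOp, fhat_sinOp, add_mul,
      Real.cos_add, Real.sin_add, Complex.real_smul]
    push_cast
    ring

theorem rot_zero (x : HperM L s × HperM L s) : rot 0 x = x := by
  simp only [rot_apply]
  refine Prod.ext (ext_fhat fun k => ?_) (ext_fhat fun k => ?_) <;>
  simp [fhat_add, fhat_sub, fhat_cosOp, fhat_sinOp]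

theorem rot_rot_neg (t : ℝ) (x : HperM L s × HperM L s) : rot t (rot (-t) x) = x := by
  rw [← rot_add, add_neg_cancel, rot_zero]

/-- The product carries the maximum norm, in which a rotation need not be an isometry; the factor 2
is the cost. -/
theorem norm_rot_le (t : ℝ) (x : HperM L s × HperM L s) : ‖rot t x‖ ≤ 2 * ‖x‖ := by
  have h1 := norm_fst_le x
  have h2 := norm_snd_le x
  rw [rot_apply, norm_prod_le_iff]
  constructor
  · refine (norm_add_le _ _).trans ?_
    linarith [norm_cosOp_le t x.1, norm_sinOp_le t x.2]
  · refine (norm_sub_le _ _).trans ?_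
    linarith [norm_cosOp_le t x.2, norm_sinOp_le t x.1]

theorem continuous_rot (x : HperM L s × HperM L s) : Continuous fun t => rot t x :=
  ((continuous_cosOp x.1).add (continuous_sinOp x.2)).prodMk
    ((continuous_cosOp x.2).sub (continuous_sinOp x.1))

theorem hasDerivAt_rot (h : r + 1 ≤ s) (x : HperM L s × HperM L s) (t : ℝ) :
    HasDerivAt (fun τ => rot τ (inclProd (Nat.le_of_succ_le h) x)) (rot t (rotGen h x)) t := by
  have h1 := (hasDerivAt_cosOp h x.1 t).add (hasDerivAt_sinOp h x.2 t)
  have h2 := (hasDerivAt_cosOp h x.2 t).sub (hasDerivAt_sinOp h x.1 t)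
  have h3 := h1.prodMk h2
  refine h3.congr_deriv ?_
  rw [rot_apply, rotGen]
  refine Prod.ext ?_ ?_
  · change -_ + _ = _ + sinOp t (-_)
    rw [map_neg, add_comm]
  · change -_ - _ = cosOp t (-_) - _
    rw [map_neg]
    abel

theorem rot_rotGen (h : r + 1 ≤ s) (t : ℝ) (x : HperM L s × HperM L s) :
    rot t (rotGen h x) = rotGen h (rot t x) := by
  simp only [rot_apply, rotGen, map_neg, map_add, map_sub]
  have hc : ∀ f : HperM L s, cosOp t (absD h f) = absD h (cosOp t f) := fun f =>
    ext_fhat fun k => by rw [fhat_cosOp, fhat_absD, fhat_absD, fhat_cosOp, smul_comm]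
  have hs : ∀ f : HperM L s, sinOp t (absD h f) = absD h (sinOp t f) := fun f =>
    ext_fhat fun k => by rw [fhat_sinOp, fhat_absD, fhat_absD, fhat_sinOp, smul_comm]
  refine Prod.ext ?_ ?_
  · simp only [hc, hs]
    abel
  · simp only [hc, hs]
    abel

theorem rot_inclProd (h : r ≤ s) (t : ℝ) (x : HperM L s × HperM L s) :
    rot t (inclProd h x) = inclProd h (rot t x) := by
  simp only [rot_apply, inclProd_apply, map_add, map_sub]
  have hc : ∀ f : HperM L s, cosOp t (inclCLM h f) = inclCLM h (cosOp t f) := fun f =>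
    ext_fhat fun k => by rw [fhat_cosOp, toL2_inclCLM, toL2_inclCLM, fhat_cosOp]
  have hs : ∀ f : HperM L s, sinOp t (inclCLM h f) = inclCLM h (sinOp t f) := fun f =>
    ext_fhat fun k => by rw [fhat_sinOp, toL2_inclCLM, toL2_inclCLM, fhat_sinOp]
  simp only [hc, hs]

end PerSobolev

end

noncomputable section

namespace PerSobolev

open Filter Topology ComplexConjugate

open HperM

variable {L : ℝ} [Fact (0 < L)]

/-! ### The interaction picture -/

section LocalLipschitz

theorem HperM.norm_inclCLM_apply_le {r s : ℕ} (h : r ≤ s) (f : HperM L s) :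
    ‖inclCLM h f‖ ≤ ‖f‖ :=
  (ContinuousLinearMap.le_of_opNorm_le _
    (LinearMap.mkContinuous_norm_le _ zero_le_one _) f).trans_eq (one_mul _)

theorem norm_nonlin_sub_le_norm_sub {f g : HperM L 3} {R : ℝ} (hf : ‖f‖ ≤ R) (hg : ‖g‖ ≤ R) :
    ‖nonlin f - nonlin g‖ ≤ (1 + 3 * (‖wienerSeq L‖ ^ 2 * R ^ 2)) * ‖f - g‖ :=
  (norm_nonlin_sub_le le_rfl hf hg).trans
    (mul_le_mul_of_nonneg_left (norm_inclCLM_apply_le (show 2 ≤ 3 by norm_num) _) (by positivity))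

theorem continuous_nonlin : Continuous (nonlin : HperM L 3 → HperM L 2) := by
  refine continuous_iff_continuousAt.2 fun f => ?_
  refine LipschitzOnWith.continuousOn (s := Metric.ball (0 : HperM L 3) (‖f‖ + 1))
    (K := Real.toNNReal (1 + 3 * (‖wienerSeq L‖ ^ 2 * (‖f‖ + 1) ^ 2)))
    (LipschitzOnWith.of_dist_le_mul fun x hx y hy => ?_) |>.continuousAt
    (Metric.isOpen_ball.mem_nhds (by simp))
  rw [Real.coe_toNNReal _ (by positivity), dist_eq_norm, dist_eq_norm]
  rw [mem_ball_zero_iff] at hx hy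
  exact norm_nonlin_sub_le_norm_sub hx.le hy.le

/-- Recovery of `φ` from `(|∂ₓ| φ, φ_t)`. -/
def recover : (HperM L 2 × HperM L 2) →L[ℝ] HperM L 3 :=
  (absDInv (show 3 ≤ 2 + 1 by norm_num)).comp (ContinuousLinearMap.fst ℝ _ _)

theorem recover_apply (x : HperM L 2 × HperM L 2) :
    recover x = absDInv (show 3 ≤ 2 + 1 by norm_num) x.1 := rfl

/-- The nonlinear term of the equation in the interaction picture. -/
def interaction (t : ℝ) (x : HperM L 2 × HperM L 2) : HperM L 2 × HperM L 2 :=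
  rot (-t) (0, nonlin (recover (rot t x)))

theorem norm_recover_rot_le (t : ℝ) (x : HperM L 2 × HperM L 2) :
    ‖recover (rot t x)‖ ≤ ‖(recover (L := L))‖ * 2 * ‖x‖ := by
  rw [mul_assoc]
  exact (ContinuousLinearMap.le_opNorm _ _).trans
    (mul_le_mul_of_nonneg_left (norm_rot_le t x) (norm_nonneg _))

theorem norm_zero_prod {E G : Type*} [NormedAddCommGroup E] [NormedAddCommGroup G] (y : G) :
    ‖((0 : E), y)‖ = ‖y‖ := by
  simp [Prod.norm_def]

theorem exists_interaction_lipschitz (R : ℝ) : ∃ K : ℝ, 0 ≤ K ∧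
    ∀ (t : ℝ) (x y : HperM L 2 × HperM L 2), ‖x‖ ≤ R → ‖y‖ ≤ R →
      ‖interaction t x - interaction t y‖ ≤ K * ‖x - y‖ := by
  set M := ‖(recover (L := L))‖ * 2 with hM
  have hM0 : 0 ≤ M := by positivity
  refine ⟨2 * ((1 + 3 * (‖wienerSeq L‖ ^ 2 * (M * R) ^ 2)) * M), by positivity,
    fun t x y hx hy => ?_⟩
  have hbd : ∀ z : HperM L 2 × HperM L 2, ‖z‖ ≤ R → ‖recover (rot t z)‖ ≤ M * R := fun z hz =>
    (norm_recover_rot_le t z).trans (mul_le_mul_of_nonneg_left hz hM0)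
  have h1 := norm_nonlin_sub_le_norm_sub (hbd x hx) (hbd y hy)
  rw [← map_sub, ← map_sub] at h1
  have h2 : ‖interaction t x - interaction t y‖ ≤
      2 * ‖nonlin (recover (rot t x)) - nonlin (recover (rot t y))‖ := by
    rw [interaction, interaction, ← map_sub, Prod.mk_sub_mk, sub_zero]
    refine (norm_rot_le _ _).trans_eq ?_
    rw [norm_zero_prod]
  calc ‖interaction t x - interaction t y‖
      ≤ 2 * ((1 + 3 * (‖wienerSeq L‖ ^ 2 * (M * R) ^ 2)) * (M * ‖x - y‖)) :=
        h2.trans (mul_le_mul_of_nonneg_left (h1.trans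
          (mul_le_mul_of_nonneg_left (norm_recover_rot_le t _) (by positivity))) (by norm_num))
    _ = _ := by ring

theorem norm_interaction_zero_le (t : ℝ) :
    ‖interaction t (0 : HperM L 2 × HperM L 2)‖ ≤ 2 * ‖nonlin (0 : HperM L 3)‖ := by
  rw [interaction, map_zero, map_zero]
  refine (norm_rot_le _ _).trans_eq ?_
  rw [norm_zero_prod]

theorem continuous_interaction (x : HperM L 2 × HperM L 2) :
    Continuous fun t => interaction t x := by
  have hy : Continuous fun t : ℝ => ((0 : HperM L 2), nonlin (recover (rot t x))) :=
    continuous_const.prodMk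
      (continuous_nonlin.comp (recover.continuous.comp (continuous_rot x)))
  rw [← continuousOn_univ] at hy ⊢
  exact continuousOn_clm_apply (A := fun t : ℝ => rot (-t)) (fun t x => norm_rot_le (-t) x)
    (fun x => (continuous_rot x).comp continuous_neg) hy

end LocalLipschitz

/-! ### Existence and uniqueness for the first order system -/

section Flow

/-- `U = (|∂ₓ| φ, φ_t)` solves the wave equation as a first order system. -/
structure IsWaveFlow (T : ℝ) (U : ℝ → HperM L 2 × HperM L 2) : Prop where
  continuousOn : ContinuousOn U (Ico 0 T)
  hasDerivWithinAt : ∀ t ∈ Ico 0 T,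
    HasDerivWithinAt (fun τ => inclProd (Nat.zero_le 2) (U τ))
      (rotGen (show 0 + 1 ≤ 2 by norm_num) (U t)
        + inclProd (Nat.zero_le 2) (0, nonlin (recover (U t)))) (Ico 0 T) t

theorem exists_interaction_solution (x₀ : HperM L 2 × HperM L 2) :
    ∃ T : ℝ, 0 < T ∧ ∃ V : ℝ → HperM L 2 × HperM L 2, V 0 = x₀ ∧
      ∀ t ∈ Icc 0 T, HasDerivWithinAt V (interaction t (V t)) (Icc 0 T) t := by
  obtain ⟨K, hK0, hK⟩ := exists_interaction_lipschitz (L := L) (‖x₀‖ + 1)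
  -- `B` bounds the right side on the closed unit ball around `x₀`. In time `1 / (B + 1)` a solution
  -- moves by at most `B / (B + 1) ≤ 1`, so it stays in the ball.
  set B := K * (‖x₀‖ + 1) + 2 * ‖nonlin (0 : HperM L 3)‖ with hB
  have hB0 : 0 ≤ B := by positivity
  have hball : ∀ x ∈ Metric.closedBall x₀ ((1 : NNReal) : ℝ), ‖x‖ ≤ ‖x₀‖ + 1 := by
    intro x hx
    rw [mem_closedBall_iff_norm, NNReal.coe_one] at hx
    linarith [norm_le_norm_add_norm_sub' x x₀]
  have hT : 0 < 1 / (B + 1) := by positivity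
  have hPL : IsPicardLindelof interaction (tmin := 0) (tmax := 1 / (B + 1))
      ⟨0, left_mem_Icc.2 hT.le⟩ x₀ 1 0 B.toNNReal K.toNNReal := by
    refine ⟨fun t _ => LipschitzOnWith.of_dist_le_mul fun x hx y hy => ?_,
      fun x _ => (continuous_interaction x).continuousOn, fun t _ x hx => ?_, ?_⟩
    · rw [Real.coe_toNNReal _ hK0, dist_eq_norm, dist_eq_norm]
      exact hK t x y (hball x hx) (hball y hy)
    · rw [Real.coe_toNNReal _ hB0]
      have h1 := hK t x 0 (hball x hx) (by rw [norm_zero]; positivity)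
      have h2 := norm_interaction_zero_le (L := L) t
      have h3 := norm_le_norm_add_norm_sub' (interaction t x) (interaction t 0)
      rw [sub_zero] at h1
      have h4 := mul_le_mul_of_nonneg_left (hball x hx) hK0
      linarith
    · rw [Real.coe_toNNReal _ hB0]
      simp only [sub_zero, sub_self, NNReal.coe_one, NNReal.coe_zero]
      rw [max_eq_left hT.le, mul_one_div, div_le_one (by positivity)]
      linarith
  obtain ⟨V, hV0, hV⟩ := hPL.exists_eq_forall_mem_Icc_hasDerivWithinAt₀
  exact ⟨_, hT, V, hV0, hV⟩

/-- Local existence for the first order system, with the derivative in `H¹ × H¹`. -/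
theorem exists_flow (x₀ : HperM L 2 × HperM L 2) :
    ∃ T : ℝ, 0 < T ∧ ∃ U : ℝ → HperM L 2 × HperM L 2, U 0 = x₀ ∧ ContinuousOn U (Ico 0 T) ∧
      ∀ t ∈ Ico 0 T, HasDerivWithinAt (fun τ => inclProd (show 1 ≤ 2 by norm_num) (U τ))
        (rotGen (show 1 + 1 ≤ 2 by norm_num) (U t)
          + inclProd (show 1 ≤ 2 by norm_num) (0, nonlin (recover (U t)))) (Ico 0 T) t := by
  obtain ⟨T, hT, V, hV0, hV⟩ := exists_interaction_solution x₀
  refine ⟨T, hT, fun t => rot t (V t), (rot_zero _).trans hV0, ?_, fun t ht => ?_⟩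
  · exact continuousOn_clm_apply (A := fun t : ℝ => rot t) norm_rot_le continuous_rot
      fun t ht => ((hV t (Ico_subset_Icc_self ht)).continuousWithinAt).mono Ico_subset_Icc_self
  · have h1 : HasDerivWithinAt (fun τ => inclProd (show 1 ≤ 2 by norm_num) (V τ))
        (inclProd (show 1 ≤ 2 by norm_num) (interaction t (V t))) (Ico 0 T) t :=
      (inclProd (show 1 ≤ 2 by norm_num)).hasFDerivAt.comp_hasDerivWithinAt t
        ((hV t (Ico_subset_Icc_self ht)).mono Ico_subset_Icc_self)
    have h2 := hasDerivWithinAt_clm_apply (A := fun t : ℝ => rot t) norm_rot_le continuous_rot h1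
      (hasDerivAt_rot (show 1 + 1 ≤ 2 by norm_num) (V t) t).hasDerivWithinAt
    simp only [rot_inclProd] at h2
    rw [rot_rotGen, interaction, rot_rot_neg] at h2
    exact h2

theorem inclProd_injective {r s : ℕ} (h : r ≤ s) :
    Function.Injective (inclProd (L := L) h) := by
  intro x y hxy
  rw [inclProd_apply, inclProd_apply, Prod.mk.injEq] at hxy
  have h1 : x.1.toL2 = y.1.toL2 := congrArg (fun f : HperM L r => f.toL2) hxy.1
  have h2 : x.2.toL2 = y.2.toL2 := congrArg (fun f : HperM L r => f.toL2) hxy.2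
  exact Prod.ext (toL2_injective h1) (toL2_injective h2)

/-- Differentiating `rot (-τ)` produces the generator with a minus sign, which cancels the linear
part of the equation. The derivative is in `L² × L²`. -/
theorem IsWaveFlow.hasDerivWithinAt_interaction {T : ℝ} {U : ℝ → HperM L 2 × HperM L 2}
    (hU : IsWaveFlow T U) {t : ℝ} (ht : t ∈ Ico 0 T) :
    HasDerivWithinAt (fun τ => rot (-τ) (inclProd (Nat.zero_le 2) (U τ)))
      (rot (-t) (inclProd (Nat.zero_le 2) (0, nonlin (recover (U t))))) (Ico 0 T) t := by
  have h1 : HasDerivAt (fun τ => rot (-τ) (inclProd (Nat.zero_le 2) (U t)))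
      (-rot (-t) (rotGen (show 0 + 1 ≤ 2 by norm_num) (U t))) t := by
    have h := (hasDerivAt_rot (show 0 + 1 ≤ 2 by norm_num) (U t) (-t)).scomp t (hasDerivAt_neg t)
    rw [neg_one_smul] at h
    exact h
  have h2 := hasDerivWithinAt_clm_apply (A := fun t : ℝ => rot (-t))
    (fun t x => norm_rot_le (-t) x) (fun x => (continuous_rot x).comp continuous_neg)
    (hU.hasDerivWithinAt t ht) h1.hasDerivWithinAt
  rwa [map_add, neg_add_cancel_left] at h2

/-- The nonlinearity is Lipschitz for the norm of `L²` on bounded sets. -/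
theorem exists_nonlin_lipschitz_L2 (R : ℝ) : ∃ K : ℝ, 0 ≤ K ∧
    ∀ x y : HperM L 2 × HperM L 2, ‖recover x‖ ≤ R → ‖recover y‖ ≤ R →
      ‖inclProd (Nat.zero_le 2) ((0 : HperM L 2), nonlin (recover x))
        - inclProd (Nat.zero_le 2) ((0 : HperM L 2), nonlin (recover y))‖ ≤
      K * ‖inclProd (Nat.zero_le 2) x - inclProd (Nat.zero_le 2) y‖ := by
  set A : HperM L 0 →L[ℝ] HperM L 0 := absDInv (show 0 ≤ 0 + 1 by norm_num) with hA
  refine ⟨(1 + 3 * (‖wienerSeq L‖ ^ 2 * R ^ 2)) * ‖A‖, by positivity, fun x y hx hy => ?_⟩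
  have h1 := norm_nonlin_sub_le (Nat.zero_le 2) hx hy
  have h2 : incl (Nat.zero_le 3) (recover x - recover y) =
      A (inclCLM (Nat.zero_le 2) (x - y).1) := by
    rw [← map_sub, recover_apply]
    refine ext_fhat fun k => ?_
    rw [toL2_incl, fhat_absDInv, fhat_absDInv, toL2_inclCLM]
  rw [h2] at h1
  have h3 : ‖inclCLM (Nat.zero_le 2) (x - y).1‖ ≤
      ‖inclProd (Nat.zero_le 2) x - inclProd (Nat.zero_le 2) y‖ := by
    rw [← map_sub]
    exact norm_fst_le (inclProd (Nat.zero_le 2) (x - y))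
  rw [inclProd_apply, inclProd_apply, Prod.mk_sub_mk, sub_self, norm_zero_prod, mul_assoc]
  exact h1.trans (mul_le_mul_of_nonneg_left ((A.le_opNorm _).trans
    (mul_le_mul_of_nonneg_left h3 (norm_nonneg _))) (by positivity))

/-- Grönwall's inequality in `L² × L²` for the difference of the two interaction pictures.
Continuity in `H² × H²` bounds both recovered functions in `H³` on `[0, t₁]`, hence supplies the
Lipschitz constant. -/
theorem IsWaveFlow.eqOn {T : ℝ} {U U' : ℝ → HperM L 2 × HperM L 2} (hU : IsWaveFlow T U)
    (hU' : IsWaveFlow T U') (h0 : U 0 = U' 0) : EqOn U U' (Ico 0 T) := by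
  intro t₁ ht₁
  have hsub : Icc 0 t₁ ⊆ Ico 0 T := fun t ht => ⟨ht.1, ht.2.trans_lt ht₁.2⟩
  obtain ⟨R₁, hR₁⟩ := isCompact_Icc.exists_bound_of_continuousOn
    (recover.continuous.comp_continuousOn (hU.continuousOn.mono hsub))
  obtain ⟨R₂, hR₂⟩ := isCompact_Icc.exists_bound_of_continuousOn
    (recover.continuous.comp_continuousOn (hU'.continuousOn.mono hsub))
  obtain ⟨K, hK0, hK⟩ := exists_nonlin_lipschitz_L2 (L := L) (max R₁ R₂)
  have hder : ∀ t ∈ Ico 0 T, HasDerivWithinAt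
      (fun τ => rot (-τ) (inclProd (Nat.zero_le 2) (U τ))
        - rot (-τ) (inclProd (Nat.zero_le 2) (U' τ)))
      (rot (-t) (inclProd (Nat.zero_le 2) (0, nonlin (recover (U t))))
        - rot (-t) (inclProd (Nat.zero_le 2) (0, nonlin (recover (U' t))))) (Ico 0 T) t :=
    fun t ht => (hU.hasDerivWithinAt_interaction ht).sub (hU'.hasDerivWithinAt_interaction ht)
  have hzero := eq_zero_of_abs_deriv_le_mul_abs_self_of_eq_zero_right (a := 0) (b := t₁)
    -- One factor 2 bounds `rot (-t)` on the nonlinear terms; the other bounds `U - U'` by its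
    -- rotated difference through `rot t`.
    (K := 2 * (K * 2))
    (fun t ht => ((hder t (hsub ht)).continuousWithinAt).mono hsub)
    (fun t ht => (hder t (hsub (Ico_subset_Icc_self ht))).mono_of_mem_nhdsWithin
      (mem_of_superset (Ico_mem_nhdsGE (ht.2.trans ht₁.2)) (Ico_subset_Ico_left ht.1)))
    (by rw [h0, sub_self]) (fun t ht => by
      have htI := Ico_subset_Icc_self ht
      rw [← map_sub]
      refine (norm_rot_le _ _).trans ?_
      rw [mul_assoc]
      refine mul_le_mul_of_nonneg_left ?_ (by norm_num)
      refine (hK (U t) (U' t) ((hR₁ t htI).trans (le_max_left _ _))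
        ((hR₂ t htI).trans (le_max_right _ _))).trans ?_
      rw [mul_assoc]
      refine mul_le_mul_of_nonneg_left ?_ hK0
      rw [← map_sub (rot (-t))]
      conv_lhs => rw [← rot_rot_neg t (inclProd (Nat.zero_le 2) (U t)
        - inclProd (Nat.zero_le 2) (U' t))]
      exact norm_rot_le _ _) t₁ (right_mem_Icc.2 ht₁.1)
  rw [← map_sub] at hzero
  have h1 := congrArg (rot t₁) hzero
  rw [rot_rot_neg, map_zero] at h1
  exact inclProd_injective _ (sub_eq_zero.1 h1)

end Flow

/-! ### Equivalence with strong solutions -/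

section StrongSolutions

theorem fhat_neg_apply (f : L2per L) (k : ℤ) : fhat (-f) k = -fhat f k := by
  rw [← zero_sub, fhat_sub, fhat_zero, zero_sub]

/-- The operator `-∂ₓ²`. -/
def negLaplacian {r : ℕ} (h : r + 1 ≤ 2) : HperM L 3 →L[ℝ] HperM L r :=
  (absD h).comp (absD (show 2 + 1 ≤ 3 by norm_num))

theorem isDerivX_negLaplacian {r : ℕ} (h : r + 1 ≤ 2) (f : HperM L 3) :
    IsDerivX 2 f.toL2 (-negLaplacian h f).toL2 := by
  intro k
  rw [toL2_neg, fhat_neg_apply]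
  change -fhat (absD h (absD _ f)).toL2 k = _
  rw [fhat_absD, fhat_absD, smul_smul, ← pow_two, freq_sq, Complex.real_smul]
  push_cast
  rw [show (2 * (Real.pi : ℂ) * Complex.I * k / L) ^ 2
    = Complex.I ^ 2 * ((2 * (Real.pi : ℂ) / L) ^ 2 * (k : ℂ) ^ 2) by ring, Complex.I_sq]
  ring

theorem IsDerivX.unique {n : ℕ} {f g h : L2per L} (hg : IsDerivX n f g) (hh : IsDerivX n f h) :
    g = h :=
  eq_of_fhat fun k => (hg k).trans (hh k).symm

theorem recover_absD (f : HperM L 3) (g : HperM L 2) :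
    recover (absD (show 2 + 1 ≤ 3 by norm_num) f, g) = f :=
  absDInv_absD (show 2 + 1 ≤ 3 by norm_num) (show 3 ≤ 2 + 1 by norm_num) f

theorem absD_recover (x : HperM L 2 × HperM L 2) :
    absD (show 2 + 1 ≤ 3 by norm_num) (recover x) = x.1 :=
  absD_absDInv (show 3 ≤ 2 + 1 by norm_num) (show 2 + 1 ≤ 3 by norm_num) x.1

/-- The equation holds almost everywhere if and only if it holds in `L²_{per,m}`. -/
theorem equation_iff {f : HperM L 3} {g : HperM L 0} :
    (∃ φxx : L2per L, IsDerivX 2 f.toL2 φxx ∧ ∀ᵐ x : AddCircle L,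
      g.toL2 x - φxx x - f.toL2 x + f.toL2 x ^ 3
        - 1 / L * (∫ y : AddCircle L, f.toL2 y ^ 3) = 0) ↔
    g = -negLaplacian (show 0 + 1 ≤ 2 by norm_num) f + incl (Nat.zero_le 2) (nonlin f) := by
  set D : HperM L 0 := -negLaplacian (show 0 + 1 ≤ 2 by norm_num) f with hD
  have hder : IsDerivX 2 f.toL2 D.toL2 := isDerivX_negLaplacian _ f
  have hval : ∀ᵐ x : AddCircle L, (D + incl (Nat.zero_le 2) (nonlin f)).toL2 x =
      D.toL2 x + (f.toL2 x - f.toL2 x ^ 3 + 1 / L * ∫ y : AddCircle L, f.toL2 y ^ 3) := by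
    filter_upwards [Lp.coeFn_add D.toL2 (nonlinL2 f), coeFn_nonlinL2 f] with x h1 h2
    rw [← h2]
    exact h1
  constructor
  · rintro ⟨φxx, hxx, h⟩
    rw [hxx.unique hder] at h
    refine toL2_injective (Lp.ext ?_)
    filter_upwards [h, hval] with x h1 h2
    rw [h2]
    linarith
  · intro h
    refine ⟨D.toL2, hder, ?_⟩
    filter_upwards [hval] with x h2
    rw [h, h2]
    ring

/-- Applying `|∂ₓ|` to the derivative of `φ` in `H²` gives the first component, and the equation
itself gives the second; only `L²` regularity is available there. -/
theorem IsStrongSolution.isWaveFlow {T : ℝ} {φ₀ : HperM L 3} {φ₁ : HperM L 2}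
    {φ : ℝ → HperM L 3} (h : IsStrongSolution T φ₀ φ₁ φ) :
    IsWaveFlow T fun t => (absD (show 2 + 1 ≤ 3 by norm_num) (φ t), dt T φ t) := by
  refine ⟨?_, fun t ht => ?_⟩
  · have h1 : ContinuousOn φ (Ico 0 T) := continuous_fst.comp_continuousOn h.continuousOn
    have h2 : ContinuousOn (dt T φ) (Ico 0 T) := continuous_snd.comp_continuousOn h.continuousOn
    exact ((absD (show 2 + 1 ≤ 3 by norm_num)).continuous.comp_continuousOn h1).prodMk h2
  · have hd := h.contDiffOn.differentiableOn one_ne_zero t ht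
    have h1 : HasDerivWithinAt (fun τ => incl (show 2 ≤ 3 by norm_num) (φ τ)) (dt T φ t)
        (Ico 0 T) t := hd.fst.hasDerivWithinAt
    have h2 : HasDerivWithinAt (fun τ => incl (show 0 ≤ 2 by norm_num) (dt T φ τ)) (dtt T φ t)
        (Ico 0 T) t := hd.snd.hasDerivWithinAt
    have h3 := (absD (L := L) (show 0 + 1 ≤ 2 by norm_num)).hasFDerivAt.comp_hasDerivWithinAt t h1
    rw [equation_iff.1 (h.equation t ht)] at h2
    have h4 := h3.prodMk h2
    rw [recover_absD]
    have hfun : (fun τ => inclProd (Nat.zero_le 2)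
        (absD (show 2 + 1 ≤ 3 by norm_num) (φ τ), dt T φ τ)) = fun τ =>
        (absD (show 0 + 1 ≤ 2 by norm_num) (incl (show 2 ≤ 3 by norm_num) (φ τ)),
          incl (show 0 ≤ 2 by norm_num) (dt T φ τ)) := by
      funext τ
      refine Prod.ext (ext_fhat fun k => ?_) rfl
      rw [inclProd_apply, toL2_inclCLM, fhat_absD, fhat_absD, toL2_incl]
    rw [hfun]
    refine h4.congr_deriv (Prod.ext ?_ rfl)
    change _ = _ + inclCLM (Nat.zero_le 2) (0 : HperM L 2)
    rw [map_zero, add_zero]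
    rfl

/-- The components of a solution of the first order system. -/
theorem hasDerivWithinAt_components {r : ℕ} (h : r + 1 ≤ 2) {S : Set ℝ} {t : ℝ}
    {U : ℝ → HperM L 2 × HperM L 2} {g : HperM L 2}
    (hU : HasDerivWithinAt (fun τ => inclProd (Nat.le_of_succ_le h) (U τ))
      (rotGen h (U t) + inclProd (Nat.le_of_succ_le h) (0, g)) S t) :
    HasDerivWithinAt (fun τ => inclCLM (Nat.le_of_succ_le h) (U τ).1) (absD h (U t).2) S t ∧
    HasDerivWithinAt (fun τ => inclCLM (Nat.le_of_succ_le h) (U τ).2)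
      (-absD h (U t).1 + inclCLM (Nat.le_of_succ_le h) g) S t := by
  rw [inclProd_apply, rotGen, Prod.mk_add_mk, map_zero, add_zero] at hU
  exact ⟨hU.fst, hU.snd⟩

theorem isWaveFlow_of_hasDerivWithinAt {r : ℕ} (h : r + 1 ≤ 2) {T : ℝ}
    {U : ℝ → HperM L 2 × HperM L 2} (hc : ContinuousOn U (Ico 0 T))
    (hU : ∀ t ∈ Ico 0 T, HasDerivWithinAt (fun τ => inclProd (Nat.le_of_succ_le h) (U τ))
        (rotGen h (U t) + inclProd (Nat.le_of_succ_le h) (0, nonlin (recover (U t))))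
        (Ico 0 T) t) : IsWaveFlow T U := by
  refine ⟨hc, fun t ht => ?_⟩
  obtain ⟨h1, h2⟩ := hasDerivWithinAt_components h (hU t ht)
  have h3 := (inclCLM (L := L) (Nat.zero_le r)).hasFDerivAt.comp_hasDerivWithinAt t h1
  have h4 := (inclCLM (L := L) (Nat.zero_le r)).hasFDerivAt.comp_hasDerivWithinAt t h2
  have hD : ∀ f : HperM L 2, inclCLM (Nat.zero_le r) (absD h f) =
      absD (show 0 + 1 ≤ 2 by norm_num) f := fun f => ext_fhat fun k => by
    rw [toL2_inclCLM, fhat_absD, fhat_absD]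
  refine (h3.prodMk h4).congr_deriv ?_
  rw [map_add, map_neg, hD, hD, inclProd_apply, rotGen, Prod.mk_add_mk, map_zero, add_zero]
  rfl

/-- The derivative is assumed in `H¹ × H¹` and not merely in `L² × L²`, because `|∂ₓ|⁻¹` gains one
derivative and `φ` has to be differentiable in `H²`. -/
theorem isStrongSolution_recover {T : ℝ} (hT : 0 < T) {U : ℝ → HperM L 2 × HperM L 2}
    (hc : ContinuousOn U (Ico 0 T))
    (hU : ∀ t ∈ Ico 0 T, HasDerivWithinAt (fun τ => inclProd (show 1 ≤ 2 by norm_num) (U τ))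
        (rotGen (show 1 + 1 ≤ 2 by norm_num) (U t)
          + inclProd (show 1 ≤ 2 by norm_num) (0, nonlin (recover (U t)))) (Ico 0 T) t) :
    IsStrongSolution T (recover (U 0)) (U 0).2 fun t => recover (U t) := by
  have huniq : UniqueDiffOn ℝ (Ico 0 T) := uniqueDiffOn_Ico 0 T
  have h1 : ∀ t ∈ Ico 0 T, HasDerivWithinAt
      (fun τ => incl (show 2 ≤ 3 by norm_num) (recover (U τ))) (U t).2 (Ico 0 T) t := by
    intro t ht
    have h := (absDInv (L := L) (show 2 ≤ 1 + 1 by norm_num)).hasFDerivAt.comp_hasDerivWithinAt t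
      (hasDerivWithinAt_components (show 1 + 1 ≤ 2 by norm_num) (hU t ht)).1
    rw [absDInv_absD] at h
    refine h.congr_of_mem (fun τ _ => ext_fhat fun k => ?_) ht
    rw [toL2_incl, recover_apply, fhat_absDInv, Function.comp_apply, fhat_absDInv, toL2_inclCLM]
  have hdt : EqOn (dt T fun t => recover (U t)) (fun t => (U t).2) (Ico 0 T) := fun t ht =>
    (h1 t ht).derivWithin (huniq t ht)
  have h2 : ∀ t ∈ Ico 0 T, HasDerivWithinAt
      (fun τ => incl (show 0 ≤ 2 by norm_num) (dt T (fun t => recover (U t)) τ))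
      (-negLaplacian (show 0 + 1 ≤ 2 by norm_num) (recover (U t))
        + incl (Nat.zero_le 2) (nonlin (recover (U t)))) (Ico 0 T) t := by
    intro t ht
    have h := (inclCLM (L := L) (Nat.zero_le 1)).hasFDerivAt.comp_hasDerivWithinAt t
      (hasDerivWithinAt_components (show 1 + 1 ≤ 2 by norm_num) (hU t ht)).2
    rw [map_add, map_neg] at h
    refine (h.congr_deriv ?_).congr_of_mem (fun τ hτ => ?_) ht
    · have h3 : inclCLM (Nat.zero_le 1) (absD (show 1 + 1 ≤ 2 by norm_num) (U t).1) =
          negLaplacian (show 0 + 1 ≤ 2 by norm_num) (recover (U t)) := by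
        rw [negLaplacian, ContinuousLinearMap.comp_apply, absD_recover]
        refine ext_fhat fun k => ?_
        rw [toL2_inclCLM, fhat_absD, fhat_absD]
      rw [h3]
      rfl
    · rw [hdt hτ]
      rfl
  have hdtt : ∀ t ∈ Ico 0 T, dtt T (fun t => recover (U t)) t =
      -negLaplacian (show 0 + 1 ≤ 2 by norm_num) (recover (U t))
        + incl (Nat.zero_le 2) (nonlin (recover (U t))) := fun t ht =>
    (h2 t ht).derivWithin (huniq t ht)
  have hrec : ContinuousOn (fun t => recover (U t)) (Ico 0 T) :=
    recover.continuous.comp_continuousOn hc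
  refine ⟨hrec.prodMk ((continuous_snd.comp_continuousOn hc).congr hdt), ?_,
    fun t ht => equation_iff.2 (hdtt t ht), rfl, hdt (left_mem_Ico.2 hT)⟩
  have h3 := fun t ht => (h1 t ht).prodMk (h2 t ht)
  rw [contDiffOn_one_iff_derivWithin huniq]
  refine ⟨fun t ht => (h3 t ht).differentiableWithinAt, ?_⟩
  have h4 : ContinuousOn (fun t => ((U t).2,
      -negLaplacian (show 0 + 1 ≤ 2 by norm_num) (recover (U t))
        + inclCLM (Nat.zero_le 2) (nonlin (recover (U t))))) (Ico 0 T) :=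
    (continuous_snd.comp_continuousOn hc).prodMk
      (((negLaplacian _).continuous.comp_continuousOn hrec).neg.add
        ((inclCLM _).continuous.comp_continuousOn (continuous_nonlin.comp_continuousOn hrec)))
  exact h4.congr fun t ht => (h3 t ht).derivWithin (huniq t ht)

end StrongSolutions

end PerSobolev

end

open PerSobolev in
theorem theorem2 (L : ℝ) [Fact (0 < L)] (φ₀ : HperM L 3) (φ₁ : HperM L 2) :
    ∃ tmax : ℝ, 0 < tmax ∧ ∃ φ : ℝ → HperM L 3,
      IsStrongSolution tmax φ₀ φ₁ φ ∧
      ∀ (T : ℝ) (χ : ℝ → HperM L 3), 0 < T → T ≤ tmax →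
        IsStrongSolution T φ₀ φ₁ χ → Set.EqOn χ φ (Set.Ico 0 T) := by
  obtain ⟨tmax, htmax, U, hU0, hc, hU⟩ :=
    exists_flow (HperM.absD (show 2 + 1 ≤ 3 by norm_num) φ₀, φ₁)
  have hsol := isStrongSolution_recover htmax hc hU
  rw [hU0, recover_absD] at hsol
  refine ⟨tmax, htmax, _, hsol, fun T χ hT hTle hχ t ht => ?_⟩
  have hsub : Ico 0 T ⊆ Ico 0 tmax := Ico_subset_Ico_right hTle
  -- The flow `U` is restricted to `[0, T)`, and not the strong solution: `dt` depends on the length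
  -- of the interval, whereas the components of `U` do not.
  have hflow : IsWaveFlow T U := isWaveFlow_of_hasDerivWithinAt (show 1 + 1 ≤ 2 by norm_num)
    (hc.mono hsub) fun t ht => (hU t (hsub ht)).mono hsub
  have heq := hχ.isWaveFlow.eqOn hflow (by rw [hχ.init, hχ.init_dt, hU0]) ht
  have h := congrArg recover heq
  rwa [recover_absD] at h
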